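/- Let $\mathscr{L}=\{\rho\in \mathrm{End}(\mathbb{C}^2\otimes\mathbb{C}^2): \rho^\dagger=\rho,\ \mathrm{tr}\,\rho=1\}$, a real affine space of dimension $15$. Let $\mathbb{R}[\mathscr{L}]$ be the ring of real polynomial functions on $\mathscr{L}$ (polynomials in the real and imaginary parts of the matrix entries of $\rho$), and let $\mathbb{R}(\mathscr{L})$ be its field of fractions. The group $\mathrm{SU}(2)\times\mathrm{SU}(2)$ acts on $\mathscr{L}$ by $\rho\mapsto (U_1\otimes U_2)\,\rho\,(U_1\otimes U_2)^\dagger$, hence on $\mathbb{R}(\mathscr{L})$ by substitution; write $\mathbb{R}(\mathscr{L})^{\mathrm{SU}(2)\times \mathrm{SU}(2)}$ for the subfield of invariant rational functions. Let $\sigma_0=I$, let $\sigma_1=\begin{pmatrix}0&1\\1&0\end{pmatrix}$, $\sigma_2=\begin{pmatrix}0&-i\\i&0\end{pmatrix}$, $\sigma_3=\begin{pmatrix}1&0\\0&-1\end{pmatrix}$ be the Pauli matrices, and put $c_{ij}(\rho)=\mathrm{tr}(\rho\,\sigma_i\otimes\sigma_j)\in\mathbb{R}$, $u_1=(c_{i0})_{i=1}^{3}$,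 $u_2=(c_{0j})_{j=1}^{3}$, $C=(c_{ij})_{i,j=1}^{3}$. With $\cdot$ and $\times$ the standard dot and cross products on three-component vectors, let $$v_1=u_1\times Cu_2,\quad w_1=u_1\times v_1,\quad v_2=u_2\times C^{T}u_1,\quad w_2=u_2\times v_2,$$ and $$f_1=u_1\cdot u_1,\quad f_2=u_2\cdot u_2,\quad f_3=v_1\cdot v_1,\quad f_4=v_2\cdot v_2,\quad f_5=u_1\cdot Cu_2,$$ $$f_6=v_1\cdot Cv_2,\quad f_7=w_1\cdot Cw_2,\quad f_8=v_1\cdot Cw_2,\quad f_9=w_1\cdot Cv_2,$$ which are polynomials with integer coefficients in the $c_{ij}$. **Theorem.** (a) The functions $f_1,\dots,f_9$ belong to $\mathbb{R}(\mathscr{L})^{\mathrm{SU}(2)\times\mathrm{SU}(2)}$, are algebraically independent over $\mathbb{R}$, and generate this field over $\mathbb{R}$. In particular it is purely transcendental over $\mathbb{R}$, isomorphic over $\mathbb{R}$ to the field of rational functions in nine variables. (b) Let $\mathscr{L}_{\mathrm{sym}}\subseteq\mathscr{L}$ be the affine subspace of those $\rho$ that are unchanged when the two tensor factors are swapped (equivalently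 $u_1=u_2$ and $C=C^{T}$). The group $\mathrm{SU}(2)$ acts on it by $\rho\mapsto (U\otimes U)\,\rho\,(U\otimes U)^\dagger$; define $\mathbb{R}(\mathscr{L}_{\mathrm{sym}})$ and its subfield $\mathbb{R}(\mathscr{L}_{\mathrm{sym}})^{\mathrm{SU}(2)}$ of invariant rational functions as above. With $u=u_1=u_2$, $v=u\times Cu$, $w=u\times v$, the six functions $$u\cdot u,\quad v\cdot v,\quad u\cdot Cu,\quad v\cdot Cv,\quad w\cdot Cw,\quad w\cdot Cv$$ belong to $\mathbb{R}(\mathscr{L}_{\mathrm{sym}})^{\mathrm{SU}(2)}$, are algebraically independent over $\mathbb{R}$, and generate this field over $\mathbb{R}$. In particular it is purely transcendental over $\mathbb{R}$, isomorphic over $\mathbb{R}$ to the field of rational functions in six variables. -/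

import Mathlib

open scoped Matrix Kronecker

noncomputable section

namespace TwoQubit

/-! ### Coordinate rings and function fields of real affine spaces of operators -/

/-- Linear operators on `ℂ² ⊗ ℂ²`, written as matrices in the product basis. -/
abbrev Op : Type := Matrix (Fin 2 × Fin 2) (Fin 2 × Fin 2) ℂ

/-- The ring `ℝ[X]` of real polynomial functions on a real affine space `X` of operators: the
functions that are polynomial in the real and imaginary parts of the matrix entries. -/
def coordRing (X : AffineSubspace ℝ Op) : Subalgebra ℝ (X → ℝ) :=
  Algebra.adjoin ℝ
    ({f | ∃ i j, f = fun ρ : X => ((ρ : Op) i j).re} ∪ {f | ∃ i j, f = fun ρ : X => ((ρ : Op) i j).im})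

/-- Every real-linear functional of the operator is a polynomial function. -/
theorem linear_mem_coordRing (X : AffineSubspace ℝ Op) (l : Op →ₗ[ℝ] ℝ) :
    (fun ρ : X => l (ρ : Op)) ∈ coordRing X := by
  have key : (fun ρ : X => l (ρ : Op)) = ∑ i, ∑ j,
      (l (Matrix.single i j 1) • (fun ρ : X => ((ρ : Op) i j).re) +
        l (Matrix.single i j Complex.I) • (fun ρ : X => ((ρ : Op) i j).im)) := by
    funext ρ
    conv_lhs => rw [Matrix.matrix_eq_sum_single (ρ : Op)]
    simp only [map_sum, Finset.sum_apply, Pi.add_apply, Pi.smul_apply, smul_eq_mul]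
    refine Finset.sum_congr rfl fun i _ => Finset.sum_congr rfl fun j _ => ?_
    have h : Matrix.single i j ((ρ : Op) i j) =
        ((ρ : Op) i j).re • Matrix.single i j (1 : ℂ) +
          ((ρ : Op) i j).im • Matrix.single i j Complex.I := by
      rw [Matrix.smul_single, Matrix.smul_single, ← Matrix.single_add]
      congr 1
      simp [Complex.re_add_im]
    rw [h, map_add, map_smul, map_smul, smul_eq_mul, smul_eq_mul, mul_comm, mul_comm (Complex.im _)]
  rw [key]
  refine Subalgebra.sum_mem _ fun i _ => Subalgebra.sum_mem _ fun j _ => ?_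
  exact Subalgebra.add_mem _
    (Subalgebra.smul_mem (coordRing X) (Algebra.subset_adjoin (Or.inl ⟨i, j, rfl⟩)) _)
    (Subalgebra.smul_mem (coordRing X) (Algebra.subset_adjoin (Or.inr ⟨i, j, rfl⟩)) _)

/-- A polynomial function restricts to a one-variable polynomial on each line. -/
theorem exists_polynomial_on_line (X : AffineSubspace ℝ Op) (x y : X) (f : X → ℝ)
    (hf : f ∈ coordRing X) :
    ∃ p : Polynomial ℝ, ∀ (t : ℝ) (z : X), (z : Op) = AffineMap.lineMap (x : Op) (y : Op) t →
      f z = p.eval t := by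
  induction hf using Algebra.adjoin_induction with
  | mem f hf =>
    rcases hf with ⟨i, j, rfl⟩ | ⟨i, j, rfl⟩
    · refine ⟨Polynomial.C (((y : Op) i j).re - ((x : Op) i j).re) * Polynomial.X
        + Polynomial.C ((x : Op) i j).re, fun t z hz => ?_⟩
      simp [hz, AffineMap.lineMap_apply]
      ring
    · refine ⟨Polynomial.C (((y : Op) i j).im - ((x : Op) i j).im) * Polynomial.X
        + Polynomial.C ((x : Op) i j).im, fun t z hz => ?_⟩
      simp [hz, AffineMap.lineMap_apply]
      ring
  | algebraMap r => exact ⟨Polynomial.C r, fun t z _ => by simp⟩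
  | add f g _ _ hf hg =>
    obtain ⟨p, hp⟩ := hf
    obtain ⟨q, hq⟩ := hg
    exact ⟨p + q, fun t z hz => by simp [hp t z hz, hq t z hz]⟩
  | mul f g _ _ hf hg =>
    obtain ⟨p, hp⟩ := hf
    obtain ⟨q, hq⟩ := hg
    exact ⟨p * q, fun t z hz => by simp [hp t z hz, hq t z hz]⟩

instance coordRing_isDomain (X : AffineSubspace ℝ Op) [Nonempty X] : IsDomain (coordRing X) := by
  have : NoZeroDivisors (coordRing X) := by
    refine ⟨fun {f g} hfg => ?_⟩
    by_contra! hne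
    obtain ⟨x, hx⟩ : ∃ x, f.1 x ≠ 0 := by
      by_contra! h
      exact hne.1 (Subtype.ext (funext h))
    obtain ⟨y, hy⟩ : ∃ y, g.1 y ≠ 0 := by
      by_contra! h
      exact hne.2 (Subtype.ext (funext h))
    obtain ⟨p, hp⟩ := exists_polynomial_on_line X x y f.1 f.2
    obtain ⟨q, hq⟩ := exists_polynomial_on_line X x y g.1 g.2
    have hpq : p * q = 0 := by
      refine Polynomial.funext fun t => ?_
      have hz := AffineMap.lineMap_mem t x.2 y.2
      have h := congrFun (congrArg Subtype.val hfg) ⟨_, hz⟩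
      rw [Polynomial.eval_mul, ← hp t ⟨_, hz⟩ rfl, ← hq t ⟨_, hz⟩ rfl]
      simpa using h
    rcases mul_eq_zero.mp hpq with h | h
    · exact hx (by rw [hp 0 x (by simp), h, Polynomial.eval_zero])
    · exact hy (by rw [hq 1 y (by simp), h, Polynomial.eval_zero])
  exact NoZeroDivisors.to_isDomain _

/-- The field `ℝ(X)` of real rational functions on `X`. -/
abbrev FunctionField (X : AffineSubspace ℝ Op) : Type := FractionRing (coordRing X)

/-! ### Invariant rational functions -/

/-- The group `G` acts on `X` through (restrictions of) real-linear maps of operators. -/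
class ActsLinearly (G : Type*) [Group G] (X : AffineSubspace ℝ Op) [MulAction G X] : Prop where
  exists_linear : ∀ g : G, ∃ T : Op →ₗ[ℝ] Op, ∀ x : X, ((g • x : X) : Op) = T (x : Op)

section Invariants

variable (G : Type*) [Group G] (X : AffineSubspace ℝ Op) [MulAction G X] [ActsLinearly G X]

theorem comp_smul_mem_coordRing (g : G) (f : X → ℝ) (hf : f ∈ coordRing X) :
    (fun x => f (g • x)) ∈ coordRing X := by
  obtain ⟨T, hT⟩ := ActsLinearly.exists_linear (X := X) g
  induction hf using Algebra.adjoin_induction with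
  | mem f hf =>
    rcases hf with ⟨i, j, rfl⟩ | ⟨i, j, rfl⟩
    · simp only [hT]
      exact linear_mem_coordRing X
        (Complex.reLm ∘ₗ (Matrix.entryLinearMap ℝ ℂ i j) ∘ₗ T)
    · simp only [hT]
      exact linear_mem_coordRing X
        (Complex.imLm ∘ₗ (Matrix.entryLinearMap ℝ ℂ i j) ∘ₗ T)
  | algebraMap r => exact Subalgebra.algebraMap_mem _ r
  | add f h _ _ hf hh => exact Subalgebra.add_mem _ hf hh
  | mul f h _ _ hf hh => exact Subalgebra.mul_mem _ hf hh

variable {G}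

/-- The automorphism `f ↦ f (g • ·)` of the ring of polynomial functions. -/
def pullback (g : G) : coordRing X ≃ₐ[ℝ] coordRing X where
  toFun f := ⟨fun x => f.1 (g • x), comp_smul_mem_coordRing G X g f.1 f.2⟩
  invFun f := ⟨fun x => f.1 (g⁻¹ • x), comp_smul_mem_coordRing G X g⁻¹ f.1 f.2⟩
  left_inv f := Subtype.ext (funext fun x => by simp)
  right_inv f := Subtype.ext (funext fun x => by simp)
  map_mul' _ _ := rfl
  map_add' _ _ := rfl
  commutes' _ := rfl

variable [Nonempty X]

/-- The automorphism `f₁ / f₂ ↦ f₁ (g • ·) / f₂ (g • ·)` of the field of rational functions. -/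
def rationalPullback (g : G) : FunctionField X ≃ₐ[ℝ] FunctionField X :=
  IsFractionRing.algEquivOfAlgEquiv (pullback X g)

variable (G)

/-- The field `ℝ(X)^G` of invariant real rational functions. -/
def invariantField : IntermediateField ℝ (FunctionField X) where
  carrier := {f | ∀ g : G, rationalPullback X g f = f}
  mul_mem' ha hb g := by rw [map_mul, ha g, hb g]
  add_mem' ha hb g := by rw [map_add, ha g, hb g]
  algebraMap_mem' r g := AlgEquiv.commutes _ r
  inv_mem' a ha g := by rw [map_inv₀, ha g]

end Invariants

/-! ### Liouville space and local unitary operators -/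

/-- The Liouville space of two qubits: Hermitian operators of trace one. -/
def liouville : AffineSubspace ℝ Op where
  carrier := {ρ | ρᴴ = ρ ∧ ρ.trace = 1}
  smul_vsub_vadd_mem' := by
    rintro c a b d ⟨ha, ha'⟩ ⟨hb, hb'⟩ ⟨hd, hd'⟩
    refine ⟨?_, ?_⟩
    · simp [Matrix.conjTranspose_add, Matrix.conjTranspose_smul, Matrix.conjTranspose_sub,
        ha, hb, hd]
    · simp [Matrix.trace_add, Matrix.trace_smul, Matrix.trace_sub, ha', hb', hd']

/-- The symmetric states in Liouville space: those unchanged when the two tensor factors are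
swapped. -/
def liouvilleSym : AffineSubspace ℝ Op where
  carrier := {ρ | ρ ∈ liouville ∧ ρ.submatrix Prod.swap Prod.swap = ρ}
  smul_vsub_vadd_mem' := by
    rintro c a b d ⟨ha, ha'⟩ ⟨hb, hb'⟩ ⟨hd, hd'⟩
    refine ⟨liouville.smul_vsub_vadd_mem c ha hb hd, ?_⟩
    simp [Matrix.submatrix_add, Matrix.submatrix_smul, Matrix.submatrix_sub, ha', hb', hd']

theorem quarter_one_mem : ((1 / 4 : ℝ) • (1 : Op)) ∈ liouvilleSym := by
  refine ⟨⟨?_, ?_⟩, ?_⟩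
  · simp [Matrix.conjTranspose_smul]
  · simp [Matrix.trace_smul]
  · simp [Matrix.submatrix_smul, Matrix.submatrix_one_equiv (Equiv.prodComm (Fin 2) (Fin 2)),
      ← Equiv.coe_prodComm]

instance : Nonempty liouville := ⟨⟨_, quarter_one_mem.1⟩⟩
instance : Nonempty liouvilleSym := ⟨⟨_, quarter_one_mem⟩⟩

abbrev SU2 : Type := Matrix.specialUnitaryGroup (Fin 2) ℂ

/-- The local unitary operator `U₁ ⊗ U₂`. -/
def localUnitary (U : SU2 × SU2) : Op := (U.1 : Matrix (Fin 2) (Fin 2) ℂ) ⊗ₖ (U.2 : Matrix _ _ ℂ)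

theorem localUnitary_mul (U W : SU2 × SU2) :
    localUnitary (U * W) = localUnitary U * localUnitary W := by
  simp [localUnitary, Matrix.mul_kronecker_mul]

theorem localUnitary_one : localUnitary 1 = 1 := by
  simp [localUnitary]

theorem localUnitary_conjTranspose_mul (U : SU2 × SU2) :
    (localUnitary U)ᴴ * localUnitary U = 1 := by
  have h1 : (U.1 : Matrix (Fin 2) (Fin 2) ℂ)ᴴ * U.1 = 1 := U.1.2.1.1
  have h2 : (U.2 : Matrix (Fin 2) (Fin 2) ℂ)ᴴ * U.2 = 1 := U.2.2.1.1
  rw [localUnitary, Matrix.conjTranspose_kronecker, ← Matrix.mul_kronecker_mul, h1, h2,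
    Matrix.one_kronecker_one]

theorem conj_mem_liouville (U : SU2 × SU2) {ρ : Op} (h : ρ ∈ liouville) :
    localUnitary U * ρ * (localUnitary U)ᴴ ∈ liouville := by
  obtain ⟨h1, h2⟩ := h
  refine ⟨?_, ?_⟩
  · simp [Matrix.conjTranspose_mul, h1, Matrix.mul_assoc]
  · rw [Matrix.trace_mul_comm, ← Matrix.mul_assoc, localUnitary_conjTranspose_mul, Matrix.one_mul,
      h2]

/-- Local unitary evolution `ρ ↦ (U₁ ⊗ U₂) ρ (U₁ ⊗ U₂)†`. -/
instance : MulAction (SU2 × SU2) liouville where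
  smul U ρ := ⟨localUnitary U * ρ * (localUnitary U)ᴴ, conj_mem_liouville U ρ.2⟩
  one_smul ρ := Subtype.ext (show localUnitary 1 * (ρ : Op) * (localUnitary 1)ᴴ = ρ by
    simp [localUnitary_one])
  mul_smul U W ρ := Subtype.ext (show localUnitary (U * W) * (ρ : Op) * (localUnitary (U * W))ᴴ
      = localUnitary U * (localUnitary W * ρ * (localUnitary W)ᴴ) * (localUnitary U)ᴴ by
    simp [localUnitary_mul, Matrix.conjTranspose_mul, Matrix.mul_assoc])

theorem conj_mem_liouvilleSym (U : SU2) {ρ : Op} (h : ρ ∈ liouvilleSym) :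
    localUnitary (U, U) * ρ * (localUnitary (U, U))ᴴ ∈ liouvilleSym := by
  obtain ⟨h1, h2⟩ := h
  refine ⟨conj_mem_liouville _ h1, ?_⟩
  have hU : (localUnitary (U, U)).submatrix Prod.swap Prod.swap = localUnitary (U, U) := by
    ext i j
    simp [localUnitary, mul_comm]
  have hU' : ((localUnitary (U, U))ᴴ).submatrix Prod.swap Prod.swap = (localUnitary (U, U))ᴴ := by
    rw [← Matrix.conjTranspose_submatrix, hU]
  have e : (Prod.swap : Fin 2 × Fin 2 → Fin 2 × Fin 2) = Equiv.prodComm (Fin 2) (Fin 2) := rfl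
  rw [e] at h2 hU hU' ⊢
  rw [← Matrix.submatrix_mul_equiv _ _ _ (Equiv.prodComm (Fin 2) (Fin 2)) _,
    ← Matrix.submatrix_mul_equiv _ _ _ (Equiv.prodComm (Fin 2) (Fin 2)) _, h2, hU, hU']

/-- `SU(2)`, embedded diagonally in `SU(2) × SU(2)`, acts on the symmetric states. -/
instance : MulAction SU2 liouvilleSym where
  smul U ρ := ⟨localUnitary (U, U) * ρ * (localUnitary (U, U))ᴴ, conj_mem_liouvilleSym U ρ.2⟩
  one_smul ρ := Subtype.ext
    (show localUnitary (1 : SU2 × SU2) * (ρ : Op) * (localUnitary (1 : SU2 × SU2))ᴴ = ρ by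
      simp [localUnitary_one])
  mul_smul U W ρ := Subtype.ext
    (show localUnitary ((U, U) * (W, W)) * (ρ : Op) * (localUnitary ((U, U) * (W, W)))ᴴ
        = localUnitary (U, U) * (localUnitary (W, W) * ρ * (localUnitary (W, W))ᴴ)
          * (localUnitary (U, U))ᴴ by
      simp only [localUnitary_mul, Matrix.conjTranspose_mul, Matrix.mul_assoc])

/-- The real-linear map `ρ ↦ A ρ A†`. -/
def conjBy (A : Op) : Op →ₗ[ℝ] Op where
  toFun ρ := A * ρ * Aᴴ
  map_add' x y := by rw [Matrix.mul_add, Matrix.add_mul]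
  map_smul' r x := by rw [Matrix.mul_smul, Matrix.smul_mul]; rfl

instance : ActsLinearly (SU2 × SU2) liouville := ⟨fun U => ⟨conjBy (localUnitary U), fun _ => rfl⟩⟩
instance : ActsLinearly SU2 liouvilleSym :=
  ⟨fun U => ⟨conjBy (localUnitary (U, U)), fun _ => rfl⟩⟩

/-! ### Bloch coordinates and the generating invariants -/

/-- The identity `σ₀` and the Pauli matrices `σ₁, σ₂, σ₃`. -/
def pauli : Fin 4 → Matrix (Fin 2) (Fin 2) ℂ :=
  ![!![1, 0; 0, 1], !![0, 1; 1, 0], !![0, -Complex.I; Complex.I, 0], !![1, 0; 0, -1]]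

/-- `ρ ↦ re tr (ρ A)` as a real-linear functional. -/
def reTraceMul (A : Op) : Op →ₗ[ℝ] ℝ where
  toFun ρ := (ρ * A).trace.re
  map_add' x y := by rw [Matrix.add_mul, Matrix.trace_add, Complex.add_re]
  map_smul' r x := by rw [Matrix.smul_mul, Matrix.trace_smul]; simp

/-- The correlation function `c i j = tr (ρ σᵢ ⊗ σⱼ)` as a polynomial function on `X`; the trace
is real because `ρ` and `σᵢ ⊗ σⱼ` are Hermitian. -/
def blochCoord (X : AffineSubspace ℝ Op) (ij : Fin 4 × Fin 4) : coordRing X :=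
  ⟨fun ρ => ((ρ : Op) * (pauli ij.1 ⊗ₖ pauli ij.2)).trace.re,
    linear_mem_coordRing X (reTraceMul (pauli ij.1 ⊗ₖ pauli ij.2))⟩

/-- Integer polynomials in indeterminates standing for the entries of the Bloch matrix. -/
abbrev BlochPoly : Type := MvPolynomial (Fin 4 × Fin 4) ℤ

/-- The generic Bloch vector `u₁` of the first qubit. -/
def u₁ : Fin 3 → BlochPoly := fun i => MvPolynomial.X (i.succ, 0)

/-- The generic Bloch vector `u₂` of the second qubit. -/
def u₂ : Fin 3 → BlochPoly := fun j => MvPolynomial.X (0, j.succ)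

/-- The generic matrix `C` of 2-point correlation functions. -/
def C : Matrix (Fin 3) (Fin 3) BlochPoly := Matrix.of fun i j => MvPolynomial.X (i.succ, j.succ)

def v₁ : Fin 3 → BlochPoly := u₁ ⨯₃ (C *ᵥ u₂)
def w₁ : Fin 3 → BlochPoly := u₁ ⨯₃ v₁
def v₂ : Fin 3 → BlochPoly := u₂ ⨯₃ (Cᵀ *ᵥ u₁)
def w₂ : Fin 3 → BlochPoly := u₂ ⨯₃ v₂

/-- The integer polynomials `f₁, …, f₉`. -/
def invariantPoly : Fin 9 → BlochPoly :=
  ![u₁ ⬝ᵥ u₁, u₂ ⬝ᵥ u₂, v₁ ⬝ᵥ v₁, v₂ ⬝ᵥ v₂,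
    u₁ ⬝ᵥ (C *ᵥ u₂), v₁ ⬝ᵥ (C *ᵥ v₂), w₁ ⬝ᵥ (C *ᵥ w₂),
    v₁ ⬝ᵥ (C *ᵥ w₂), w₁ ⬝ᵥ (C *ᵥ v₂)]

/-- `v = u × Cu` for symmetric states, where `u = u₁ = u₂`. -/
def vSym : Fin 3 → BlochPoly := u₁ ⨯₃ (C *ᵥ u₁)

/-- `w = u × v` for symmetric states. -/
def wSym : Fin 3 → BlochPoly := u₁ ⨯₃ vSym

/-- The integer polynomials `f₁, …, f₆` for symmetric states. -/
def invariantPolySym : Fin 6 → BlochPoly :=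
  ![u₁ ⬝ᵥ u₁, vSym ⬝ᵥ vSym, u₁ ⬝ᵥ (C *ᵥ u₁), vSym ⬝ᵥ (C *ᵥ vSym),
    wSym ⬝ᵥ (C *ᵥ wSym), wSym ⬝ᵥ (C *ᵥ vSym)]

/-- The function on `X`, as an element of `ℝ(X)`, obtained by evaluating an integer polynomial at
the entries of the Bloch matrix. -/
def evalBloch (X : AffineSubspace ℝ Op) (p : BlochPoly) : FunctionField X :=
  algebraMap (coordRing X) (FunctionField X) (MvPolynomial.aeval (blochCoord X) p)

end TwoQubit

end

/-! The proof constructs a section of the invariants that is rational up to signs. For a generic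
state the vectors u₁, v₁, w₁ are orthogonal, with squared lengths f₁, f₃, f₁f₃, and likewise u₂, v₂,
w₂ with f₂, f₄, f₂f₄. Since SU(2) covers SO(3) (`exists_su2_of_rotation`), local unitaries can
rotate both frames onto the coordinate axes. The Bloch vectors become (t₀,0,0) and (t₁,0,0), where
t₀² = f₁ and t₁² = f₂, and with t₂² = f₃ and t₃² = f₄ every entry of C is a Laurent expression in
t₀, …, t₃ and f₅, …, f₉. Two entries vanish because v₂ ⟂ Cᵀu₁ and v₁ ⟂ Cu₂, two more are fixed by
u₁·Cw₂ = -f₄ and w₁·Cu₂ = -f₃, and the other five are f₅, …, f₉ up to normalization. Hence the orbit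
of a state with f₁f₂f₃f₄ ≠ 0 is determined by the values of f (`exists_rotation_to_section`).

On this section s the f_i restrict to t₀², …, t₃², t₄, …, t₈, which have no algebraic relation; this
is independence. Conversely, an invariant fraction p/q restricts to a rational function of t.
Parameters that differ in the signs of t₀, …, t₃ give points of the same orbit, so this function is
even in each of those variables, hence rational in their squares (`exists_descent`): it is R(f) for
a rational R. Every generic orbit meets the section, so p/q = R(f) throughout
(`exists_mul_aeval_eq`).

Symmetric states need only one frame, with two square roots and six parameters. Both cases are
instances of `invariantField_of_section`. -/

/-! ### Descent of rational functions along sign changes of variables -/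

namespace SignDescent

open MvPolynomial

variable {ι : Type*}

/-- A polynomial vanishing wherever the coordinates are positive is zero. -/
theorem eq_zero_of_eval_pos (P : MvPolynomial ι ℝ)
    (h : ∀ t : ι → ℝ, (∀ i, 0 < t i) → eval t P = 0) : P = 0 := by
  refine funext_set (fun _ => Set.Ioi (0 : ℝ)) (fun _ => Set.Ioi_infinite 0) fun t ht => ?_
  rw [h t fun i => ht i (Set.mem_univ i), map_zero]

variable [DecidableEq ι]

/-- Square the coordinates in `J`. -/
def sqAt (J : Finset ι) (t : ι → ℝ) : ι → ℝ := fun i => if i ∈ J then t i ^ 2 else t i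

/-- Change the sign of the `j`-th coordinate. -/
def negAt (j : ι) (t : ι → ℝ) : ι → ℝ := fun i => if i = j then -t i else t i

/-- Substitute `X i ^ 2` for `X i` when `i ∈ J`. -/
noncomputable def sqHom (J : Finset ι) : MvPolynomial ι ℝ →ₐ[ℝ] MvPolynomial ι ℝ :=
  aeval fun i => if i ∈ J then X i ^ 2 else X i

/-- Substitute `-X j` for `X j`. -/
noncomputable def negHom (j : ι) : MvPolynomial ι ℝ →ₐ[ℝ] MvPolynomial ι ℝ :=
  aeval fun i => if i = j then -X i else X i

theorem eval_sqHom (J : Finset ι) (t : ι → ℝ) (P : MvPolynomial ι ℝ) :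
    eval t (sqHom J P) = eval (sqAt J t) P := by
  induction P using MvPolynomial.induction_on with
  | C a => simp [sqHom]
  | add p q hp hq => simp [hp, hq]
  | mul_X p i hp =>
    rw [map_mul, map_mul, hp, map_mul]
    congr 1
    by_cases h : i ∈ J <;> simp [sqHom, sqAt, h]

theorem eval_negHom (j : ι) (t : ι → ℝ) (P : MvPolynomial ι ℝ) :
    eval t (negHom j P) = eval (negAt j t) P := by
  induction P using MvPolynomial.induction_on with
  | C a => simp [negHom]
  | add p q hp hq => simp [hp, hq]
  | mul_X p i hp =>
    rw [map_mul, map_mul, hp, map_mul]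
    congr 1
    by_cases h : i = j <;> simp [negHom, negAt, h]

theorem sqHom_injective (J : Finset ι) : Function.Injective (sqHom J) := by
  rw [injective_iff_map_eq_zero]
  refine fun P hP => eq_zero_of_eval_pos P fun t ht => ?_
  -- Positive points are squares: evaluating at their roots recovers the values of `P` there.
  have h := eval_sqHom J (fun i => if i ∈ J then √(t i) else t i) P
  rw [hP, map_zero] at h
  rw [h]
  congr 2
  funext i
  by_cases hi : i ∈ J <;> simp [sqAt, hi, Real.sq_sqrt (ht i).le]

theorem negHom_injective (j : ι) : Function.Injective (negHom j) := by
  have h : ∀ P, negHom j (negHom j P) = P := fun P => by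
    refine MvPolynomial.funext fun t => ?_
    rw [eval_negHom, eval_negHom]
    congr 2
    funext i
    by_cases hi : i = j <;> simp [negAt, hi]
  exact Function.LeftInverse.injective h

theorem sqHom_empty (P : MvPolynomial ι ℝ) : sqHom ∅ P = P := by
  simp [sqHom]

theorem sqHom_insert {j : ι} {J : Finset ι} (hj : j ∉ J) (P : MvPolynomial ι ℝ) :
    sqHom {j} (sqHom J P) = sqHom (insert j J) P := by
  refine MvPolynomial.funext fun t => ?_
  rw [eval_sqHom, eval_sqHom, eval_sqHom]
  congr 2
  funext i
  by_cases hi : i = j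
  · subst hi; simp [sqAt, hj]
  · simp [sqAt, hi]

theorem negHom_sqHom_singleton {i j : ι} (hij : i ≠ j) (P : MvPolynomial ι ℝ) :
    negHom i (sqHom {j} P) = sqHom {j} (negHom i P) := by
  refine MvPolynomial.funext fun t => ?_
  rw [eval_sqHom, eval_negHom, eval_sqHom, eval_negHom]
  congr 2
  funext k
  by_cases hk : k = j
  · subst hk; simp [sqAt, negAt, hij.symm]
  · simp [sqAt, negAt, hk]

theorem negHom_sqHom_self (j : ι) (P : MvPolynomial ι ℝ) :
    negHom j (sqHom {j} P) = sqHom {j} P := by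
  refine MvPolynomial.funext fun t => ?_
  rw [eval_negHom, eval_sqHom, eval_sqHom]
  congr 2
  funext k
  by_cases hk : k = j <;> simp [sqAt, negAt, hk]

/-- Even and odd parts with respect to one variable. -/
theorem exists_even_odd (j : ι) (P : MvPolynomial ι ℝ) :
    ∃ P₀ P₁, P = sqHom {j} P₀ + X j * sqHom {j} P₁ := by
  induction P using MvPolynomial.induction_on with
  | C a => exact ⟨MvPolynomial.C a, 0, by simp [sqHom]⟩
  | add p q hp hq =>
    obtain ⟨p₀, p₁, hp⟩ := hp
    obtain ⟨q₀, q₁, hq⟩ := hq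
    refine ⟨p₀ + q₀, p₁ + q₁, ?_⟩
    rw [hp, hq, map_add, map_add]
    ring
  | mul_X p i hp =>
    obtain ⟨p₀, p₁, hp⟩ := hp
    by_cases hi : i = j
    · subst hi
      refine ⟨X i * p₁, p₀, ?_⟩
      have : sqHom {i} (X i) = (X i ^ 2 : MvPolynomial ι ℝ) := by simp [sqHom]
      rw [hp, map_mul, this]
      ring
    · refine ⟨p₀ * X i, p₁ * X i, ?_⟩
      have : sqHom {j} (X i) = (X i : MvPolynomial ι ℝ) := by simp [sqHom, hi]
      rw [hp, map_mul, map_mul, this]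
      ring

/-- Rationalize the denominator with the conjugate `M = negHom j Q`. Then `M * Q` is a norm, hence
even in `X j`, and the odd part of `M * P` vanishes because of the invariance `h`. -/
theorem exists_descent_one (j : ι) (P Q : MvPolynomial ι ℝ) (hQ : Q ≠ 0)
    (h : negHom j P * Q = P * negHom j Q) :
    ∃ P' Q' M, Q' ≠ 0 ∧ sqHom {j} P' = M * P ∧ sqHom {j} Q' = M * Q := by
  obtain ⟨p₀, p₁, hp⟩ := exists_even_odd j P
  obtain ⟨q₀, q₁, hq⟩ := exists_even_odd j Q
  have hX : sqHom {j} (X j) = (X j ^ 2 : MvPolynomial ι ℝ) := by simp [sqHom]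
  have hnX : negHom j (X j) = (-X j : MvPolynomial ι ℝ) := by simp [negHom]
  have hnp : negHom j P = sqHom {j} p₀ - X j * sqHom {j} p₁ := by
    rw [hp, map_add, map_mul, negHom_sqHom_self, negHom_sqHom_self, hnX]
    ring
  have hnq : negHom j Q = sqHom {j} q₀ - X j * sqHom {j} q₁ := by
    rw [hq, map_add, map_mul, negHom_sqHom_self, negHom_sqHom_self, hnX]
    ring
  have hQ' : sqHom {j} (q₀ ^ 2 - X j * q₁ ^ 2) = negHom j Q * Q := by
    rw [hnq, hq, map_sub, map_mul, map_pow, map_pow, hX]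
    ring
  have hcross : sqHom {j} p₁ * sqHom {j} q₀ = sqHom {j} p₀ * sqHom {j} q₁ := by
    rw [hnp, hnq, hp, hq] at h
    have : (2 * X j : MvPolynomial ι ℝ) ≠ 0 := mul_ne_zero two_ne_zero (X_ne_zero j)
    refine mul_left_cancel₀ this ?_
    linear_combination -h
  refine ⟨p₀ * q₀ - X j * p₁ * q₁, q₀ ^ 2 - X j * q₁ ^ 2, negHom j Q, ?_, ?_, hQ'⟩
  · intro h0
    rw [h0, map_zero] at hQ'
    rcases mul_eq_zero.mp hQ'.symm with h1 | h1
    · exact hQ (negHom_injective j (by rw [h1, map_zero]))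
    · exact hQ h1
  · rw [hnq, hp, map_sub, map_mul, map_mul, map_mul, hX]
    linear_combination -X j * hcross

/-- A rational function invariant under the sign changes of the variables in `J` is a rational
function of their squares. -/
theorem exists_descent (J : Finset ι) : ∀ P Q : MvPolynomial ι ℝ, Q ≠ 0 →
    (∀ j ∈ J, negHom j P * Q = P * negHom j Q) →
    ∃ P' Q' M, Q' ≠ 0 ∧ sqHom J P' = M * P ∧ sqHom J Q' = M * Q := by
  induction J using Finset.induction_on with
  | empty => exact fun P Q hQ _ => ⟨P, Q, 1, hQ, by simp [sqHom_empty], by simp [sqHom_empty]⟩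
  | insert j J hj ih =>
    intro P Q hQ h
    obtain ⟨P₁, Q₁, M, hQ₁, hP, hQ'⟩ :=
      exists_descent_one j P Q hQ (h j (Finset.mem_insert_self j J))
    obtain ⟨P₂, Q₂, M₂, hQ₂, hP₂, hQ₂'⟩ := ih P₁ Q₁ hQ₁ fun i hi => by
      have hij : i ≠ j := fun e => hj (e ▸ hi)
      -- The remaining sign changes survive the first descent: substituting `X j ^ 2` is injective
      -- and commutes with the sign change of any other variable.
      refine sqHom_injective {j} ?_
      rw [map_mul, map_mul, ← negHom_sqHom_singleton hij, ← negHom_sqHom_singleton hij, hP, hQ',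
        map_mul, map_mul]
      linear_combination negHom i M * M * h i (Finset.mem_insert_of_mem hi)
    refine ⟨P₂, Q₂, sqHom {j} M₂ * M, hQ₂, ?_, ?_⟩
    · rw [← sqHom_insert hj, hP₂, map_mul, hP, mul_assoc]
    · rw [← sqHom_insert hj, hQ₂', map_mul, hQ', mul_assoc]

end SignDescent

/-! ### Invariant fields from a rational section up to signs -/

namespace TwoQubit

open SignDescent

/-! ### Laurent functions of the section parameters -/

section Laurent

variable {ι : Type*} (J : Finset ι)

/-- A function that agrees, where the coordinates in `J` do not vanish, with a polynomial divided
by a power of the product of these coordinates. -/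
def IsLaurent (φ : (ι → ℝ) → ℝ) : Prop :=
  ∃ (N : ℕ) (P : MvPolynomial ι ℝ), ∀ t : ι → ℝ, (∀ i ∈ J, t i ≠ 0) →
    φ t * (∏ i ∈ J, t i) ^ N = MvPolynomial.eval t P

variable {J} {φ ψ : (ι → ℝ) → ℝ}

theorem IsLaurent.congr (h : IsLaurent J φ) (e : ∀ t, (∀ i ∈ J, t i ≠ 0) → ψ t = φ t) :
    IsLaurent J ψ := by
  obtain ⟨N, P, hP⟩ := h
  exact ⟨N, P, fun t ht => by rw [e t ht, hP t ht]⟩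

theorem IsLaurent.const (a : ℝ) : IsLaurent J fun _ => a :=
  ⟨0, MvPolynomial.C a, fun t _ => by simp⟩

theorem IsLaurent.coord (i : ι) : IsLaurent J fun t => t i :=
  ⟨0, MvPolynomial.X i, fun t _ => by simp⟩

theorem IsLaurent.add (hφ : IsLaurent J φ) (hψ : IsLaurent J ψ) :
    IsLaurent J fun t => φ t + ψ t := by
  obtain ⟨N, P, hP⟩ := hφ
  obtain ⟨M, Q, hQ⟩ := hψ
  refine ⟨N + M, P * (∏ i ∈ J, MvPolynomial.X i) ^ M + Q * (∏ i ∈ J, MvPolynomial.X i) ^ N,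
    fun t ht => ?_⟩
  simp only [map_add, map_mul, map_pow, map_prod, MvPolynomial.eval_X, ← hP t ht, ← hQ t ht]
  ring

theorem IsLaurent.mul (hφ : IsLaurent J φ) (hψ : IsLaurent J ψ) :
    IsLaurent J fun t => φ t * ψ t := by
  obtain ⟨N, P, hP⟩ := hφ
  obtain ⟨M, Q, hQ⟩ := hψ
  refine ⟨N + M, P * Q, fun t ht => ?_⟩
  simp only [map_mul, ← hP t ht, ← hQ t ht]
  ring

theorem IsLaurent.inv_coord [DecidableEq ι] {i : ι} (hi : i ∈ J) :
    IsLaurent J fun t => (t i)⁻¹ := by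
  refine ⟨1, ∏ j ∈ J.erase i, MvPolynomial.X j, fun t ht => ?_⟩
  rw [pow_one, ← Finset.mul_prod_erase J t hi, ← mul_assoc, inv_mul_cancel₀ (ht i hi), one_mul,
    map_prod]
  simp

theorem IsLaurent.sum {κ : Type*} (s : Finset κ) {φ : κ → (ι → ℝ) → ℝ}
    (h : ∀ k ∈ s, IsLaurent J (φ k)) : IsLaurent J fun t => ∑ k ∈ s, φ k t := by
  classical
  induction s using Finset.induction_on with
  | empty => simpa using IsLaurent.const (J := J) 0
  | insert k s hk ih =>
    simp only [Finset.sum_insert hk]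
    exact (h k (Finset.mem_insert_self k s)).add
      (ih fun i hi => h i (Finset.mem_insert_of_mem hi))

/-- Laurent functions form an algebra, and the coordinate ring is generated by the real and
imaginary parts of the entries. -/
theorem IsLaurent.comp_coordRing {X : AffineSubspace ℝ Op} {s : (ι → ℝ) → X}
    (hre : ∀ a b, IsLaurent J fun t => ((s t : Op) a b).re)
    (him : ∀ a b, IsLaurent J fun t => ((s t : Op) a b).im)
    {p : X → ℝ} (hp : p ∈ coordRing X) : IsLaurent J fun t => p (s t) := by
  induction hp using Algebra.adjoin_induction with
  | mem f hf =>
    rcases hf with ⟨a, b, rfl⟩ | ⟨a, b, rfl⟩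
    · exact hre a b
    · exact him a b
  | algebraMap r => exact IsLaurent.const r
  | add f g _ _ hf hg => exact hf.add hg
  | mul f g _ _ hf hg => exact hf.mul hg

/-- Two Laurent functions have a common denominator. -/
theorem IsLaurent.exists_common (hφ : IsLaurent J φ) (hψ : IsLaurent J ψ) :
    ∃ (N : ℕ) (P Q : MvPolynomial ι ℝ), ∀ t : ι → ℝ, (∀ i ∈ J, t i ≠ 0) →
      φ t * (∏ i ∈ J, t i) ^ N = MvPolynomial.eval t P ∧
      ψ t * (∏ i ∈ J, t i) ^ N = MvPolynomial.eval t Q := by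
  obtain ⟨N, P, hP⟩ := hφ
  obtain ⟨M, Q, hQ⟩ := hψ
  refine ⟨N + M, P * (∏ i ∈ J, MvPolynomial.X i) ^ M, Q * (∏ i ∈ J, MvPolynomial.X i) ^ N,
    fun t ht => ⟨?_, ?_⟩⟩
  · simp only [map_mul, map_pow, map_prod, MvPolynomial.eval_X, ← hP t ht]
    ring
  · simp only [map_mul, map_pow, map_prod, MvPolynomial.eval_X, ← hQ t ht]
    ring

end Laurent

/-! ### Invariant fields from a section that is rational up to signs -/

section Section

variable {G : Type*} [Group G] {X : AffineSubspace ℝ Op} [MulAction G X] [ActsLinearly G X]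
  [Nonempty X]

omit [Nonempty X] in
theorem rationalPullback_algebraMap (g : G) (p : coordRing X) :
    rationalPullback X g (algebraMap _ (FunctionField X) p) = algebraMap _ _ (pullback X g p) := by
  exact IsFractionRing.algEquivOfAlgEquiv_algebraMap (pullback X g) p

theorem mem_invariantField_of_invariant (f : coordRing X) (hf : ∀ (g : G) x, f.1 (g • x) = f.1 x) :
    algebraMap _ (FunctionField X) f ∈ invariantField G X := fun g => by
  rw [rationalPullback_algebraMap]
  congr 1
  exact Subtype.ext (funext fun x => hf g x)

omit [Nonempty X] in
theorem algebraMap_functionField_ne_zero {q : coordRing X} (hq : q ≠ 0) :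
    algebraMap _ (FunctionField X) q ≠ 0 := fun h =>
  hq (IsFractionRing.injective (coordRing X) (FunctionField X) (by rw [h, map_zero]))

/-- An invariant fraction `p / q` satisfies the cross-multiplied invariance. -/
theorem invariant_cross_mul {p q : coordRing X} (hq : q ≠ 0)
    (h : algebraMap _ (FunctionField X) p / algebraMap _ _ q ∈ invariantField G X) (g : G) :
    pullback X g p * q = p * pullback X g q := by
  have hq' : algebraMap _ (FunctionField X) q ≠ 0 := algebraMap_functionField_ne_zero hq
  have hgq : algebraMap _ (FunctionField X) (pullback X g q) ≠ 0 :=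
    algebraMap_functionField_ne_zero ((map_ne_zero_iff _ (pullback X g).injective).mpr hq)
  have := h g
  rw [map_div₀, rationalPullback_algebraMap, rationalPullback_algebraMap,
    div_eq_div_iff hgq hq', ← map_mul, ← map_mul] at this
  exact IsFractionRing.injective (coordRing X) (FunctionField X) this

omit [Nonempty X] in
theorem aeval_coordRing_apply {ι : Type*} (f : ι → coordRing X) (P : MvPolynomial ι ℝ) (x : X) :
    (MvPolynomial.aeval f P).1 x = MvPolynomial.eval (fun i => (f i).1 x) P := by
  induction P using MvPolynomial.induction_on with
  | C a => simp
  | add p q hp hq => simp [hp, hq]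
  | mul_X p i hp => simp [hp]

omit [Nonempty X] in
theorem aeval_algebraMap_eq {ι : Type*} (f : ι → coordRing X) (P : MvPolynomial ι ℝ) :
    MvPolynomial.aeval (fun i => algebraMap _ (FunctionField X) (f i)) P =
      algebraMap _ (FunctionField X) (MvPolynomial.aeval f P) :=
  MvPolynomial.aeval_algebraMap_apply (FunctionField X) f P

variable {ι : Type*} [DecidableEq ι] {J : Finset ι} {f : ι → coordRing X} {s : (ι → ℝ) → X}

omit [Nonempty X] in
-- Along the section `f` takes the values `sqAt J t`, so a relation among the `f i` becomes a
-- relation among the variables and their squares, and substituting squares is injective.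
theorem eq_zero_of_aeval_eq_zero
    (hfs : ∀ t, (∀ i ∈ J, t i ≠ 0) → ∀ i, (f i).1 (s t) = sqAt J t i) (P : MvPolynomial ι ℝ)
    (hP : MvPolynomial.aeval f P = 0) : P = 0 := by
  refine sqHom_injective J ?_
  rw [map_zero]
  refine eq_zero_of_eval_pos _ fun t ht => ?_
  have h := aeval_coordRing_apply f P (s t)
  rw [hP] at h
  rw [eval_sqHom, ← funext (hfs t fun i _ => (ht i).ne'), ← h]
  rfl

omit [Nonempty X] in
theorem algebraicIndependent_of_section
    (hfs : ∀ t, (∀ i ∈ J, t i ≠ 0) → ∀ i, (f i).1 (s t) = sqAt J t i) :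
    AlgebraicIndependent ℝ fun i => algebraMap _ (FunctionField X) (f i) := by
  rw [algebraicIndependent_iff]
  intro P hP
  rw [aeval_algebraMap_eq] at hP
  exact eq_zero_of_aeval_eq_zero hfs P
    (IsFractionRing.injective (coordRing X) (FunctionField X) (by rw [hP, map_zero]))

omit [Nonempty X] in
-- Over ℝ the parameters are square roots, so nonnegativity of the `f i` with `i ∈ J` is what lets
-- every generic point be matched with a real point of the section.
theorem exists_sq_eq (hnn : ∀ i ∈ J, ∀ x, 0 ≤ (f i).1 x) (x : X)
    (hx : ∀ i ∈ J, (f i).1 x ≠ 0) :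
    ∃ t : ι → ℝ, (∀ i ∈ J, t i ≠ 0) ∧ ∀ i, (f i).1 x = sqAt J t i := by
  refine ⟨fun i => if i ∈ J then √((f i).1 x) else (f i).1 x, fun i hi => ?_, fun i => ?_⟩
  · simpa [hi, Real.sqrt_eq_zero (hnn i hi x)] using hx i hi
  · by_cases hi : i ∈ J <;> simp [sqAt, hi]
    exact (Real.sq_sqrt (hnn i hi x)).symm

omit [Nonempty X] [DecidableEq ι] in
theorem prod_apply_ne_zero_iff {x : X} :
    (∏ i ∈ J, f i).1 x ≠ 0 ↔ ∀ i ∈ J, (f i).1 x ≠ 0 := by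
  have : (∏ i ∈ J, f i).1 x = ∏ i ∈ J, (f i).1 x := by simp [Finset.prod_apply]
  rw [this, Finset.prod_ne_zero_iff]

omit [Nonempty X] in
theorem prod_ne_zero_of_section
    (hfs : ∀ t, (∀ i ∈ J, t i ≠ 0) → ∀ i, (f i).1 (s t) = sqAt J t i) : ∏ i ∈ J, f i ≠ 0 := by
  intro h0
  have h1 : (∏ i ∈ J, f i).1 (s 1) ≠ 0 :=
    prod_apply_ne_zero_iff.mpr fun i hi => by simp [hfs 1 (by simp) i, sqAt]
  exact h1 (by rw [h0]; rfl)

/-- An invariant rational function is a fraction whose denominator does not vanish identically on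
the section. -/
theorem exists_div_ne_zero_on_section
    (hnn : ∀ i ∈ J, ∀ x, 0 ≤ (f i).1 x)
    (hfs : ∀ t, (∀ i ∈ J, t i ≠ 0) → ∀ i, (f i).1 (s t) = sqAt J t i)
    (horb : ∀ x t, (∀ i ∈ J, t i ≠ 0) → (∀ i, (f i).1 x = sqAt J t i) → ∃ g : G, g • x = s t)
    {h : FunctionField X} (hh : h ∈ invariantField G X) :
    ∃ (p q : coordRing X) (t : ι → ℝ), (∀ i ∈ J, t i ≠ 0) ∧
      q.1 (s t) ≠ 0 ∧ h = algebraMap _ (FunctionField X) p / algebraMap _ _ q := by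
  obtain ⟨p, q, hq, rfl⟩ := IsFractionRing.div_surjective (A := coordRing X) h
  have hq0 : q ≠ 0 := nonZeroDivisors.ne_zero hq
  -- The denominator `q` may vanish on the whole section, so start from a point off it, chosen
  -- generic enough for its orbit to meet the section.
  obtain ⟨x, hx⟩ : ∃ x, (q * ∏ i ∈ J, f i).1 x ≠ 0 := by
    by_contra! h0
    exact mul_ne_zero hq0 (prod_ne_zero_of_section hfs) (Subtype.ext (funext h0))
  have hx1 : q.1 x ≠ 0 := fun h0 => hx (show q.1 x * (∏ i ∈ J, f i).1 x = 0 by rw [h0, zero_mul])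
  have hx2 : ∀ i ∈ J, (f i).1 x ≠ 0 := prod_apply_ne_zero_iff.mp fun h0 =>
    hx (show q.1 x * (∏ i ∈ J, f i).1 x = 0 by rw [h0, mul_zero])
  obtain ⟨t, ht, hxt⟩ := exists_sq_eq hnn x hx2
  obtain ⟨g, hg⟩ := horb x t ht hxt
  -- Translating numerator and denominator by `g⁻¹` leaves the invariant fraction unchanged and
  -- gives the new denominator the value `q x ≠ 0` at `s t`.
  refine ⟨pullback X g⁻¹ p, pullback X g⁻¹ q, t, ht, ?_, ?_⟩
  · change q.1 (g⁻¹ • s t) ≠ 0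
    rw [← hg, inv_smul_smul]
    exact hx1
  · have := hh g⁻¹
    rw [map_div₀, rationalPullback_algebraMap, rationalPullback_algebraMap] at this
    exact this.symm

omit [ActsLinearly G X] in
/-- A fraction of polynomial functions that is constant on the orbits is a rational function of
the `f i`. -/
theorem exists_mul_aeval_eq
    (hnn : ∀ i ∈ J, ∀ x, 0 ≤ (f i).1 x)
    (hfs : ∀ t, (∀ i ∈ J, t i ≠ 0) → ∀ i, (f i).1 (s t) = sqAt J t i)
    (hre : ∀ a b, IsLaurent J fun t => ((s t : Op) a b).re)
    (him : ∀ a b, IsLaurent J fun t => ((s t : Op) a b).im)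
    (horb : ∀ x t, (∀ i ∈ J, t i ≠ 0) → (∀ i, (f i).1 x = sqAt J t i) → ∃ g : G, g • x = s t)
    {p q : coordRing X} {t₀ : ι → ℝ} (ht₀ : ∀ i ∈ J, t₀ i ≠ 0) (hq₀ : q.1 (s t₀) ≠ 0)
    (hcross : ∀ (g : G) x, p.1 (g • x) * q.1 x = p.1 x * q.1 (g • x)) :
    ∃ P' Q' : MvPolynomial ι ℝ, MvPolynomial.aeval f Q' ≠ 0 ∧
      p * MvPolynomial.aeval f Q' = MvPolynomial.aeval f P' * q := by
  obtain ⟨N, P, Q, hPQ⟩ := IsLaurent.exists_common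
    (IsLaurent.comp_coordRing hre him p.2) (IsLaurent.comp_coordRing hre him q.2)
  have hQ0 : Q ≠ 0 := by
    rintro rfl
    have := (hPQ t₀ ht₀).2
    rw [map_zero] at this
    exact mul_ne_zero hq₀ (pow_ne_zero _ (Finset.prod_ne_zero_iff.mpr ht₀)) this
  -- Flipping the sign of `t j` does not change the squares, so both section points lie in one
  -- orbit, where `p / q` is constant.
  have hflip : ∀ j ∈ J, negHom j P * Q = P * negHom j Q := by
    intro j hj
    refine sub_eq_zero.mp (eq_zero_of_eval_pos _ fun t ht => ?_)
    have ht' : ∀ i ∈ J, t i ≠ 0 := fun i _ => (ht i).ne'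
    have hnt : ∀ i ∈ J, negAt j t i ≠ 0 := fun i _ => by
      by_cases e : i = j <;> simp [negAt, e, (ht _).ne']
    obtain ⟨g, hg⟩ := horb (s t) (negAt j t) hnt fun i => by
      rw [hfs t ht']
      by_cases e : i = j
      · subst e; simp [sqAt, negAt, hj]
      · simp [sqAt, negAt, e]
    have h1 := hcross g (s t)
    rw [hg] at h1
    rw [map_sub, map_mul, map_mul, eval_negHom, eval_negHom, ← (hPQ t ht').1, ← (hPQ t ht').2,
      ← (hPQ _ hnt).1, ← (hPQ _ hnt).2]
    linear_combination (∏ i ∈ J, negAt j t i) ^ N * (∏ i ∈ J, t i) ^ N * h1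
  obtain ⟨P', Q', M, hQ', hMP, hMQ⟩ := exists_descent J P Q hQ0 hflip
  have hQf : MvPolynomial.aeval f Q' ≠ 0 := fun h0 => hQ' (eq_zero_of_aeval_eq_zero hfs Q' h0)
  -- The coordinate ring is a domain, so the identity may be multiplied by the nonzero product of
  -- the `f i` and by Q'(f). This leaves only points whose orbit meets the section.
  refine ⟨P', Q', hQf, mul_left_cancel₀ (mul_ne_zero (prod_ne_zero_of_section hfs) hQf)
    (Subtype.ext (funext fun x => ?_))⟩
  set D := ∏ i ∈ J, f i with hD
  change D.1 x * (MvPolynomial.aeval f Q').1 x *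
      (p.1 x * (MvPolynomial.aeval f Q').1 x) = D.1 x *
      (MvPolynomial.aeval f Q').1 x * ((MvPolynomial.aeval f P').1 x * q.1 x)
  by_cases hx : D.1 x = 0
  · rw [hx]; ring
  by_cases hQx : (MvPolynomial.aeval f Q').1 x = 0
  · rw [hQx]; ring
  congr 1
  have hx' : ∀ i ∈ J, (f i).1 x ≠ 0 := prod_apply_ne_zero_iff.mp hx
  -- P'(f x) and Q'(f x) are p(s t) and q(s t) times one common factor, M(t)(∏ t i)^N. Invariance
  -- along the orbit from `x` to `s t` then gives the identity.
  obtain ⟨t, ht, hxt⟩ := exists_sq_eq hnn x hx'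
  obtain ⟨g, hg⟩ := horb x t ht hxt
  have h1 := hcross g x
  rw [hg] at h1
  have hP1 := congrArg (MvPolynomial.eval t) hMP
  have hQ1 := congrArg (MvPolynomial.eval t) hMQ
  rw [eval_sqHom, map_mul, ← funext hxt, ← aeval_coordRing_apply f, ← (hPQ t ht).1] at hP1
  rw [eval_sqHom, map_mul, ← funext hxt, ← aeval_coordRing_apply f, ← (hPQ t ht).2] at hQ1
  rw [hP1, hQ1]
  linear_combination -(MvPolynomial.eval t M * (∏ i ∈ J, t i) ^ N) * h1

theorem invariant_mem_adjoin_of_section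
    (hnn : ∀ i ∈ J, ∀ x, 0 ≤ (f i).1 x)
    (hfs : ∀ t, (∀ i ∈ J, t i ≠ 0) → ∀ i, (f i).1 (s t) = sqAt J t i)
    (hre : ∀ a b, IsLaurent J fun t => ((s t : Op) a b).re)
    (him : ∀ a b, IsLaurent J fun t => ((s t : Op) a b).im)
    (horb : ∀ x t, (∀ i ∈ J, t i ≠ 0) → (∀ i, (f i).1 x = sqAt J t i) → ∃ g : G, g • x = s t)
    {h : FunctionField X} (hh : h ∈ invariantField G X) :
    h ∈ IntermediateField.adjoin ℝ
      (Set.range fun i => algebraMap _ (FunctionField X) (f i)) := by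
  obtain ⟨p, q, t₀, ht₀, hq₀, rfl⟩ := exists_div_ne_zero_on_section hnn hfs horb hh
  have hq0 : q ≠ 0 := fun h0 => hq₀ (by rw [h0]; rfl)
  obtain ⟨P', Q', hQf, key⟩ := exists_mul_aeval_eq hnn hfs hre him horb ht₀ hq₀ fun g x =>
    congrFun (congrArg Subtype.val (invariant_cross_mul hq0 hh g)) x
  have hq' : algebraMap _ (FunctionField X) q ≠ 0 := algebraMap_functionField_ne_zero hq0
  have hQf' : algebraMap _ (FunctionField X) (MvPolynomial.aeval f Q') ≠ 0 :=
    algebraMap_functionField_ne_zero hQf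
  have : algebraMap _ (FunctionField X) p / algebraMap _ _ q =
      algebraMap _ _ (MvPolynomial.aeval f P') / algebraMap _ _ (MvPolynomial.aeval f Q') := by
    rw [div_eq_div_iff hq' hQf', ← map_mul, ← map_mul, key]
  rw [this, ← aeval_algebraMap_eq, ← aeval_algebraMap_eq]
  have hmem : ∀ R : MvPolynomial ι ℝ,
      MvPolynomial.aeval (fun i => algebraMap _ (FunctionField X) (f i)) R ∈
      IntermediateField.adjoin ℝ (Set.range fun i => algebraMap _ (FunctionField X) (f i)) :=
    fun R => IntermediateField.algebra_adjoin_le_adjoin ℝ _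
      (by rw [Algebra.adjoin_range_eq_range_aeval]; exact ⟨R, rfl⟩)
  exact div_mem (hmem P') (hmem Q')

/-- Let `f` be a family of invariant polynomials and `s` a rational section on which the `f i`
restrict to the coordinates `t i`, or to their squares for `i ∈ J`. If points outside the zero
locus of the `f i`, `i ∈ J`, are determined up to `G` by the values of `f`, then the field of
invariants is purely transcendental with basis `f`. -/
theorem invariantField_of_section
    (hinv : ∀ i (g : G) x, (f i).1 (g • x) = (f i).1 x)
    (hnn : ∀ i ∈ J, ∀ x, 0 ≤ (f i).1 x)
    (hfs : ∀ t, (∀ i ∈ J, t i ≠ 0) → ∀ i, (f i).1 (s t) = sqAt J t i)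
    (hre : ∀ a b, IsLaurent J fun t => ((s t : Op) a b).re)
    (him : ∀ a b, IsLaurent J fun t => ((s t : Op) a b).im)
    (horb : ∀ x t, (∀ i ∈ J, t i ≠ 0) → (∀ i, (f i).1 x = sqAt J t i) → ∃ g : G, g • x = s t) :
    (∀ i, algebraMap _ (FunctionField X) (f i) ∈ invariantField G X) ∧
      AlgebraicIndependent ℝ (fun i => algebraMap _ (FunctionField X) (f i)) ∧
      IntermediateField.adjoin ℝ (Set.range fun i => algebraMap _ (FunctionField X) (f i)) =
        invariantField G X ∧
      Nonempty (FractionRing (MvPolynomial ι ℝ) ≃ₐ[ℝ] invariantField G X) := by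
  have hmem : ∀ i, algebraMap _ (FunctionField X) (f i) ∈ invariantField G X :=
    fun i => mem_invariantField_of_invariant (f i) (hinv i)
  have halg := algebraicIndependent_of_section hfs
  have hadj : IntermediateField.adjoin ℝ
      (Set.range fun i => algebraMap _ (FunctionField X) (f i)) = invariantField G X := by
    refine le_antisymm ?_ fun h hh =>
      invariant_mem_adjoin_of_section hnn hfs hre him horb hh
    rw [IntermediateField.adjoin_le_iff]
    rintro _ ⟨i, rfl⟩
    exact hmem i
  exact ⟨hmem, halg, hadj,
    ⟨halg.aevalEquivField.trans (IntermediateField.equivOfEq hadj)⟩⟩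

end Section

end TwoQubit

/-! ### The double cover of the rotation group by `SU(2)` -/

namespace TwoQubit

/-- The special unitary matrix attached to a unit quaternion. -/
def quatMatrix (q : Fin 4 → ℝ) : Matrix (Fin 2) (Fin 2) ℂ :=
  !![⟨q 0, q 3⟩, ⟨q 2, q 1⟩; ⟨-q 2, q 1⟩, ⟨q 0, -q 3⟩]

/-- The rotation matrix attached to a unit quaternion. -/
def quatRotation (q : Fin 4 → ℝ) : Matrix (Fin 3) (Fin 3) ℝ :=
  !![q 0 ^ 2 + q 1 ^ 2 - q 2 ^ 2 - q 3 ^ 2, 2 * (q 1 * q 2 + q 0 * q 3),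
      2 * (q 1 * q 3 - q 0 * q 2);
    2 * (q 1 * q 2 - q 0 * q 3), q 0 ^ 2 - q 1 ^ 2 + q 2 ^ 2 - q 3 ^ 2, 2 * (q 2 * q 3 + q 0 * q 1);
    2 * (q 1 * q 3 + q 0 * q 2), 2 * (q 2 * q 3 - q 0 * q 1), q 0 ^ 2 - q 1 ^ 2 - q 2 ^ 2 + q 3 ^ 2]

theorem exists_quat (U : SU2) :
    ∃ q : Fin 4 → ℝ, q 0 ^ 2 + q 1 ^ 2 + q 2 ^ 2 + q 3 ^ 2 = 1 ∧
      (U : Matrix (Fin 2) (Fin 2) ℂ) = quatMatrix q := by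
  obtain ⟨A, hA, hdet⟩ := U
  have hdet' : A.det = 1 := hdet
  -- Adjoint and adjugate are both inverses of `A`; comparing entries expresses the second row
  -- through the first.
  have h1 : Aᴴ = A.adjugate := by
    have h2 : A * A.adjugate = 1 := by rw [Matrix.mul_adjugate, hdet', one_smul]
    have h3 : Aᴴ * A = 1 := hA.1
    exact left_inv_eq_right_inv h3 h2
  rw [Matrix.adjugate_fin_two] at h1
  have h00 := congrFun (congrFun h1 0) 0
  have h01 := congrFun (congrFun h1 0) 1
  simp [Matrix.conjTranspose_apply, Complex.ext_iff] at h00 h01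
  refine ⟨![(A 0 0).re, (A 0 1).im, (A 0 1).re, (A 0 0).im], ?_, ?_⟩
  · rw [Matrix.det_fin_two] at hdet'
    have := congrArg Complex.re hdet'
    simp [← h00.1, ← h00.2] at this
    simp
    rw [h01.1, h01.2] at this
    linear_combination this
  · ext i j
    fin_cases i <;> fin_cases j <;> apply Complex.ext <;> simp [quatMatrix] <;> linarith

theorem quatMatrix_mem {q : Fin 4 → ℝ} (hq : q 0 ^ 2 + q 1 ^ 2 + q 2 ^ 2 + q 3 ^ 2 = 1) :
    quatMatrix q ∈ Matrix.specialUnitaryGroup (Fin 2) ℂ := by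
  rw [Matrix.mem_specialUnitaryGroup_iff, Matrix.mem_unitaryGroup_iff]
  constructor
  · ext i j
    fin_cases i <;> fin_cases j <;> apply Complex.ext <;>
      simp [quatMatrix, Matrix.mul_apply, Fin.sum_univ_two, Matrix.star_apply] <;> linarith
  · rw [Matrix.det_fin_two]
    apply Complex.ext <;> simp [quatMatrix] <;> linarith

/-- The adjoint stands on the left because tr(UρU†σ) = tr(ρU†σU): in this convention Bloch vectors
are transformed by the rotation itself, not by its transpose. -/
theorem quatMatrix_conj_pauli (q : Fin 4 → ℝ) (i : Fin 3) :
    (quatMatrix q)ᴴ * pauli i.succ * quatMatrix q =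
      ∑ j : Fin 3, (quatRotation q i j : ℂ) • pauli j.succ := by
  ext a b
  fin_cases i <;> fin_cases a <;> fin_cases b <;> apply Complex.ext <;>
    simp [quatMatrix, quatRotation, pauli, Matrix.mul_apply, Fin.sum_univ_succ,
      Matrix.conjTranspose_apply] <;> norm_cast <;> ring

theorem quatRotation_mul_transpose {q : Fin 4 → ℝ}
    (hq : q 0 ^ 2 + q 1 ^ 2 + q 2 ^ 2 + q 3 ^ 2 = 1) :
    quatRotation q * (quatRotation q)ᵀ = 1 := by
  have h : (q 0 ^ 2 + q 1 ^ 2 + q 2 ^ 2 + q 3 ^ 2) ^ 2 = 1 := by rw [hq, one_pow]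
  ext i j
  fin_cases i <;> fin_cases j <;> simp [quatRotation, Matrix.mul_apply, Fin.sum_univ_three] <;>
    first | linear_combination h | ring

/-- The determinant is identically the cube of the squared norm of `q`. -/
theorem det_quatRotation {q : Fin 4 → ℝ} (hq : q 0 ^ 2 + q 1 ^ 2 + q 2 ^ 2 + q 3 ^ 2 = 1) :
    (quatRotation q).det = 1 := by
  have h : (q 0 ^ 2 + q 1 ^ 2 + q 2 ^ 2 + q 3 ^ 2) ^ 3 = 1 := by rw [hq, one_pow]
  rw [Matrix.det_fin_three]
  simp [quatRotation]
  linear_combination h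

/-- A symmetric matrix of rank one and positive trace is the square of a vector. -/
theorem exists_eq_mul_of_rank_one {ι : Type*} [Fintype ι] (K : ι → ι → ℝ)
    (hK : ∀ m i j, K m i * K m j = K m m * K i j) (htr : 0 < ∑ i, K i i) :
    ∃ q : ι → ℝ, ∀ i j, q i * q j = K i j := by
  obtain ⟨m, -, hm⟩ := Finset.exists_lt_of_sum_lt (s := Finset.univ) (f := fun _ : ι => (0 : ℝ))
    (g := fun i => K i i) (by simpa using htr)
  -- Positive trace provides a positive diagonal entry `K m m`; the row through it is √(K m m) times
  -- the vector sought.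
  refine ⟨fun i => K m i / √(K m m), fun i j => ?_⟩
  rw [div_mul_div_comm, hK, Real.mul_self_sqrt hm.le, mul_div_cancel_left₀ _ hm.ne']

/-- Four times the products of the components of the quaternion of a rotation. -/
def quatProducts (A : Matrix (Fin 3) (Fin 3) ℝ) : Matrix (Fin 4) (Fin 4) ℝ :=
  !![1 + A 0 0 + A 1 1 + A 2 2, A 1 2 - A 2 1, A 2 0 - A 0 2, A 0 1 - A 1 0;
    A 1 2 - A 2 1, 1 + A 0 0 - A 1 1 - A 2 2, A 0 1 + A 1 0, A 0 2 + A 2 0;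
    A 2 0 - A 0 2, A 0 1 + A 1 0, 1 - A 0 0 + A 1 1 - A 2 2, A 1 2 + A 2 1;
    A 0 1 - A 1 0, A 0 2 + A 2 0, A 1 2 + A 2 1, 1 - A 0 0 - A 1 1 + A 2 2]

theorem adjugate_eq_transpose {A : Matrix (Fin 3) (Fin 3) ℝ} (hA : A * Aᵀ = 1) (hd : A.det = 1) :
    A.adjugate = Aᵀ := by
  have h2 : A.adjugate * A = 1 := by rw [Matrix.adjugate_mul, hd, one_smul]
  exact left_inv_eq_right_inv h2 hA

/-- Each of these minors is a linear combination of three families of quadratic identities: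
orthonormality of rows, orthonormality of columns, and equality of every entry with its cofactor. -/
theorem quatProducts_rank_one {A : Matrix (Fin 3) (Fin 3) ℝ} (hA : A * Aᵀ = 1) (hd : A.det = 1)
    (m i j : Fin 4) :
    quatProducts A m i * quatProducts A m j = quatProducts A m m * quatProducts A i j := by
  have hA' : Aᵀ * A = 1 := mul_eq_one_comm.mp hA
  have hc := adjugate_eq_transpose hA hd
  rw [Matrix.adjugate_fin_three] at hc
  rw [← Matrix.ext_iff] at hA hA' hc
  simp [Fin.forall_fin_succ, Matrix.mul_apply, Fin.sum_univ_three] at hA hA' hc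
  obtain ⟨⟨a1, a2, a3⟩, ⟨a4, a5, a6⟩, a7, a8, a9⟩ := hA
  obtain ⟨⟨b1, b2, b3⟩, ⟨b4, b5, b6⟩, b7, b8, b9⟩ := hA'
  obtain ⟨⟨c1, c2, c3⟩, ⟨c4, c5, c6⟩, c7, c8, c9⟩ := hc
  fin_cases m <;> fin_cases i <;> fin_cases j <;> simp [quatProducts] <;> linarith

theorem exists_quatRotation_eq {A : Matrix (Fin 3) (Fin 3) ℝ} (hA : A * Aᵀ = 1)
    (hd : A.det = 1) :
    ∃ q : Fin 4 → ℝ, q 0 ^ 2 + q 1 ^ 2 + q 2 ^ 2 + q 3 ^ 2 = 1 ∧ quatRotation q = A := by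
  obtain ⟨q, hq⟩ := exists_eq_mul_of_rank_one (quatProducts A) (quatProducts_rank_one hA hd)
    -- The trace of `quatProducts A` is identically 4, and the same factor four is why the
    -- components are halved below.
    (by simp [quatProducts, Fin.sum_univ_four]; linarith)
  simp [quatProducts, Fin.forall_fin_succ] at hq
  obtain ⟨⟨a1, a2, a3, a4⟩, ⟨-, b1, b2, b3⟩, ⟨-, -, c1, c2⟩, -, -, -, d1⟩ := hq
  refine ⟨fun i => q i / 2, ?_, ?_⟩
  · dsimp only
    linarith
  · ext i j
    fin_cases i <;> fin_cases j <;> simp [quatRotation] <;> linarith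

/-- The Bloch rotation of a special unitary matrix, defined by its action on Pauli matrices. -/
theorem exists_rotation (U : SU2) :
    ∃ R : Matrix (Fin 3) (Fin 3) ℝ, R * Rᵀ = 1 ∧ R.det = 1 ∧ ∀ i : Fin 3,
      (U : Matrix (Fin 2) (Fin 2) ℂ)ᴴ * pauli i.succ * U =
        ∑ j : Fin 3, (R i j : ℂ) • pauli j.succ := by
  obtain ⟨q, hq, hU⟩ := exists_quat U
  exact ⟨quatRotation q, quatRotation_mul_transpose hq, det_quatRotation hq, fun i => by
    rw [hU, quatMatrix_conj_pauli]⟩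

theorem exists_su2_of_rotation {R : Matrix (Fin 3) (Fin 3) ℝ} (hR : R * Rᵀ = 1)
    (hd : R.det = 1) : ∃ U : SU2, ∀ i : Fin 3,
      (U : Matrix (Fin 2) (Fin 2) ℂ)ᴴ * pauli i.succ * U =
        ∑ j : Fin 3, (R i j : ℂ) • pauli j.succ := by
  obtain ⟨q, hq, rfl⟩ := exists_quatRotation_eq hR hd
  exact ⟨⟨quatMatrix q, quatMatrix_mem hq⟩, quatMatrix_conj_pauli q⟩

/-- Rotations preserve the cross product. -/
theorem mulVec_cross_mulVec {R : Matrix (Fin 3) (Fin 3) ℝ} (hR : R * Rᵀ = 1) (hd : R.det = 1)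
    (a b : Fin 3 → ℝ) : (R *ᵥ a) ⨯₃ (R *ᵥ b) = R *ᵥ (a ⨯₃ b) := by
  -- The coefficients of Ra × Rb are the 2×2 minors of `R`, and for a rotation these are its
  -- entries.
  have hc := adjugate_eq_transpose hR hd
  rw [Matrix.adjugate_fin_three, ← Matrix.ext_iff] at hc
  simp [Fin.forall_fin_succ] at hc
  obtain ⟨⟨c1, c2, c3⟩, ⟨c4, c5, c6⟩, c7, c8, c9⟩ := hc
  ext i
  fin_cases i <;> simp [cross_apply, Matrix.mulVec, dotProduct, Fin.sum_univ_three]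
  · rw [← c1, ← c4, ← c7]; ring
  · rw [← c2, ← c5, ← c8]; ring
  · rw [← c3, ← c6, ← c9]; ring

theorem mulVec_dotProduct_mulVec {R : Matrix (Fin 3) (Fin 3) ℝ} (hR : R * Rᵀ = 1)
    (a b : Fin 3 → ℝ) : (R *ᵥ a) ⬝ᵥ (R *ᵥ b) = a ⬝ᵥ b := by
  rw [Matrix.dotProduct_mulVec, ← Matrix.mulVec_transpose, Matrix.mulVec_mulVec,
    mul_eq_one_comm.mp hR, Matrix.one_mulVec]

end TwoQubit

/-! ### Bloch coordinates -/

noncomputable section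

namespace TwoQubit

/-- The Bloch matrix of an operator. -/
def bloch (ρ : Op) (i j : Fin 4) : ℝ := reTraceMul (pauli i ⊗ₖ pauli j) ρ

/-- The operator with a given Bloch matrix. -/
def ofBloch (B : Fin 4 → Fin 4 → ℝ) : Op :=
  (1 / 4 : ℝ) • ∑ i, ∑ j, B i j • (pauli i ⊗ₖ pauli j)

theorem pauli_conjTranspose (i : Fin 4) : (pauli i)ᴴ = pauli i := by
  ext a b
  fin_cases i <;> fin_cases a <;> fin_cases b <;> simp [pauli, Matrix.conjTranspose_apply]

theorem trace_pauli (i : Fin 4) : (pauli i).trace = if i = 0 then 2 else 0 := by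
  fin_cases i <;> simp [pauli, Matrix.trace_fin_two, one_add_one_eq_two]

theorem trace_pauli_mul (i j : Fin 4) :
    (pauli i * pauli j).trace = if i = j then 2 else 0 := by
  fin_cases i <;> fin_cases j <;> simp [pauli, Matrix.trace_fin_two] <;> norm_num

theorem reTraceMul_apply (A ρ : Op) : reTraceMul A ρ = (ρ * A).trace.re := rfl

theorem bloch_ofBloch (B : Fin 4 → Fin 4 → ℝ) : bloch (ofBloch B) = B := by
  funext i j
  -- The products σᵢ ⊗ σⱼ are orthogonal for the trace form with squared norm 4, which cancels the
  -- factor 1/4 in `ofBloch`.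
  have h : ∀ k l, reTraceMul (pauli i ⊗ₖ pauli j) (pauli k ⊗ₖ pauli l) =
      if k = i then if l = j then 4 else 0 else 0 := fun k l => by
    rw [reTraceMul_apply, ← Matrix.mul_kronecker_mul, Matrix.trace_kronecker, trace_pauli_mul,
      trace_pauli_mul]
    split_ifs <;> simp <;> norm_num
  simp [bloch, ofBloch, h]
  ring

theorem ofBloch_mem_liouville {B : Fin 4 → Fin 4 → ℝ} (hB : B 0 0 = 1) :
    ofBloch B ∈ liouville := by
  refine ⟨?_, ?_⟩
  · simp [ofBloch, Matrix.conjTranspose_smul, Matrix.conjTranspose_sum,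
      Matrix.conjTranspose_kronecker, pauli_conjTranspose]
  · simp [ofBloch, Matrix.trace_smul, Matrix.trace_sum, Matrix.trace_kronecker, trace_pauli, hB]
    norm_num

theorem kronecker_submatrix_swap (A B : Matrix (Fin 2) (Fin 2) ℂ) :
    (A ⊗ₖ B).submatrix Prod.swap Prod.swap = B ⊗ₖ A := by
  ext i j
  simp [mul_comm]

theorem ofBloch_mem_liouvilleSym {B : Fin 4 → Fin 4 → ℝ} (hB : B 0 0 = 1)
    (hsym : ∀ i j, B i j = B j i) : ofBloch B ∈ liouvilleSym := by
  refine ⟨ofBloch_mem_liouville hB, ?_⟩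
  ext a b
  simp only [ofBloch, Matrix.submatrix_apply, Matrix.smul_apply, Matrix.sum_apply]
  rw [Finset.sum_comm]
  refine congrArg _ (Finset.sum_congr rfl fun i _ => Finset.sum_congr rfl fun j _ => ?_)
  rw [hsym j i]
  simp [mul_comm]

/-- Swapping the tensor factors fixes `ρ`, exchanges the two Pauli matrices and preserves the trace.
-/
theorem bloch_symm {ρ : Op} (h : ρ ∈ liouvilleSym) (i j : Fin 4) : bloch ρ i j = bloch ρ j i := by
  rw [bloch, bloch, reTraceMul_apply, reTraceMul_apply, ← kronecker_submatrix_swap (pauli j)]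
  conv_lhs => rw [← h.2]
  have e : (Prod.swap : Fin 2 × Fin 2 → Fin 2 × Fin 2) = Equiv.prodComm (Fin 2) (Fin 2) := rfl
  rw [e, Matrix.submatrix_mul_equiv]
  exact congrArg Complex.re (Equiv.sum_comp (Equiv.prodComm (Fin 2) (Fin 2))
    fun a => (ρ * (pauli j ⊗ₖ pauli i)) a a)

theorem bloch_zero_zero {ρ : Op} (h : ρ ∈ liouville) : bloch ρ 0 0 = 1 := by
  have : pauli 0 = 1 := by ext i j; fin_cases i <;> fin_cases j <;> simp [pauli]
  rw [bloch, reTraceMul_apply, this, Matrix.one_kronecker_one, Matrix.mul_one, h.2, Complex.one_re]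

/-- A Hermitian operator is determined by its Bloch matrix. -/
theorem eq_zero_of_bloch_eq_zero {ρ : Op} (h : ρᴴ = ρ) (hb : ∀ i j, bloch ρ i j = 0) : ρ = 0 := by
  have hh : ∀ a b c d, (ρ (a, b) (c, d)).re = (ρ (c, d) (a, b)).re ∧
      (ρ (a, b) (c, d)).im = -(ρ (c, d) (a, b)).im := fun a b c d => by
    have := congrFun (congrFun h (a, b)) (c, d)
    rw [Matrix.conjTranspose_apply] at this
    rw [← this]
    simp
  -- In real and imaginary parts, the sixteen Bloch equations together with hermiticity form a
  -- linear system with only the zero solution.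
  simp [bloch, reTraceMul_apply, pauli, Matrix.trace, Matrix.mul_apply, Fintype.sum_prod_type,
    Fin.forall_fin_succ] at hb
  simp [Fin.forall_fin_two] at hh
  ext ⟨a, b⟩ ⟨c, d⟩
  fin_cases a <;> fin_cases b <;> fin_cases c <;> fin_cases d <;> apply Complex.ext <;> simp <;>
    linarith

theorem eq_of_bloch_eq {ρ τ : Op} (hρ : ρ ∈ liouville) (hτ : τ ∈ liouville)
    (h : ∀ i j, bloch ρ i j = bloch τ i j) : ρ = τ := by
  refine sub_eq_zero.mp (eq_zero_of_bloch_eq_zero ?_ fun i j => ?_)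
  · rw [Matrix.conjTranspose_sub, hρ.1, hτ.1]
  · rw [bloch, map_sub]
    exact sub_eq_zero.mpr (h i j)

end TwoQubit

end

/-! ### The invariants in terms of Bloch vectors and the correlation matrix -/

noncomputable section

namespace TwoQubit

/-- Real rotation matrices in three dimensions. -/
def IsRotation (R : Matrix (Fin 3) (Fin 3) ℝ) : Prop := R * Rᵀ = 1 ∧ R.det = 1

/-- The values of `f₁, …, f₉` for Bloch vectors `a`, `b` and correlation matrix `M`. -/
def invariants (a b : Fin 3 → ℝ) (M : Matrix (Fin 3) (Fin 3) ℝ) : Fin 9 → ℝ :=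
  let v := a ⨯₃ (M *ᵥ b)
  let v' := b ⨯₃ (Mᵀ *ᵥ a)
  ![a ⬝ᵥ a, b ⬝ᵥ b, v ⬝ᵥ v, v' ⬝ᵥ v', a ⬝ᵥ (M *ᵥ b), v ⬝ᵥ (M *ᵥ v'),
    (a ⨯₃ v) ⬝ᵥ (M *ᵥ (b ⨯₃ v')), v ⬝ᵥ (M *ᵥ (b ⨯₃ v')), (a ⨯₃ v) ⬝ᵥ (M *ᵥ v')]

/-- The values of the six symmetric invariants for Bloch vector `a` and correlation matrix `M`. -/
def invariantsSym (a : Fin 3 → ℝ) (M : Matrix (Fin 3) (Fin 3) ℝ) : Fin 6 → ℝ :=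
  let v := a ⨯₃ (M *ᵥ a)
  ![a ⬝ᵥ a, v ⬝ᵥ v, a ⬝ᵥ (M *ᵥ a), v ⬝ᵥ (M *ᵥ v), (a ⨯₃ v) ⬝ᵥ (M *ᵥ (a ⨯₃ v)),
    (a ⨯₃ v) ⬝ᵥ (M *ᵥ v)]

theorem rotation_mulVec_conj {R S : Matrix (Fin 3) (Fin 3) ℝ} (hS : IsRotation S)
    (M : Matrix (Fin 3) (Fin 3) ℝ) (b : Fin 3 → ℝ) :
    (R * M * Sᵀ) *ᵥ (S *ᵥ b) = R *ᵥ (M *ᵥ b) := by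
  rw [Matrix.mulVec_mulVec, Matrix.mul_assoc, mul_eq_one_comm.mp hS.1, Matrix.mul_one,
    ← Matrix.mulVec_mulVec]

/-- Every construction is equivariant: v₁ and w₁ rotate with `R`, v₂ and w₂ with `S`, and `M`
intertwines the two, so all the dot products are unchanged. The cross products require determinant
one. -/
theorem invariants_rotation {R S : Matrix (Fin 3) (Fin 3) ℝ} (hR : IsRotation R)
    (hS : IsRotation S) (a b : Fin 3 → ℝ) (M : Matrix (Fin 3) (Fin 3) ℝ) :
    invariants (R *ᵥ a) (S *ᵥ b) (R * M * Sᵀ) = invariants a b M := by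
  have ht : (R * M * Sᵀ)ᵀ = S * Mᵀ * Rᵀ := by
    rw [Matrix.transpose_mul, Matrix.transpose_mul, Matrix.transpose_transpose, Matrix.mul_assoc]
  simp only [invariants, ht, rotation_mulVec_conj hS, rotation_mulVec_conj hR,
    mulVec_cross_mulVec hR.1 hR.2, mulVec_cross_mulVec hS.1 hS.2, mulVec_dotProduct_mulVec hR.1,
    mulVec_dotProduct_mulVec hS.1]

theorem invariantsSym_rotation {R : Matrix (Fin 3) (Fin 3) ℝ} (hR : IsRotation R)
    (a : Fin 3 → ℝ) (M : Matrix (Fin 3) (Fin 3) ℝ) :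
    invariantsSym (R *ᵥ a) (R * M * Rᵀ) = invariantsSym a M := by
  simp only [invariantsSym, rotation_mulVec_conj hR, mulVec_cross_mulVec hR.1 hR.2,
    mulVec_dotProduct_mulVec hR.1]

/-- The right-handed frame along `a`, `v` and `a × v`, normalized by the factors `s` and `s'`. -/
def frame (a v : Fin 3 → ℝ) (s s' : ℝ) : Matrix (Fin 3) (Fin 3) ℝ :=
  Matrix.of ![s⁻¹ • a, s'⁻¹ • v, (s⁻¹ * s'⁻¹) • (a ⨯₃ v)]

theorem frame_zero (a v : Fin 3 → ℝ) (s s' : ℝ) : frame a v s s' 0 = s⁻¹ • a := rfl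

theorem frame_one (a v : Fin 3 → ℝ) (s s' : ℝ) : frame a v s s' 1 = s'⁻¹ • v := rfl

theorem frame_two (a v : Fin 3 → ℝ) (s s' : ℝ) :
    frame a v s s' 2 = (s⁻¹ * s'⁻¹) • (a ⨯₃ v) := rfl

/-- The roots `s` and `s'` may have either sign: the third row carries the product of both, so the
frame stays right-handed. This freedom puts section points with flipped parameters in the same
orbit. -/
theorem frame_isRotation {a v : Fin 3 → ℝ} {s s' : ℝ} (hs : s ≠ 0) (hs' : s' ≠ 0)
    (ha : a ⬝ᵥ a = s ^ 2) (hv : v ⬝ᵥ v = s' ^ 2) (hav : a ⬝ᵥ v = 0) :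
    IsRotation (frame a v s s') := by
  have hw : (a ⨯₃ v) ⬝ᵥ (a ⨯₃ v) = s ^ 2 * s' ^ 2 := by
    rw [cross_dot_cross, ha, hv, hav, zero_mul, sub_zero]
  have hva : v ⬝ᵥ a = 0 := by rw [dotProduct_comm, hav]
  have h1 : a ⬝ᵥ (a ⨯₃ v) = 0 := dot_self_cross a v
  have h2 : v ⬝ᵥ (a ⨯₃ v) = 0 := dot_cross_self a v
  have h3 : (a ⨯₃ v) ⬝ᵥ a = 0 := by rw [dotProduct_comm, h1]
  have h4 : (a ⨯₃ v) ⬝ᵥ v = 0 := by rw [dotProduct_comm, h2]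
  constructor
  · ext i j
    change frame a v s s' i ⬝ᵥ frame a v s s' j = _
    fin_cases i <;> fin_cases j <;>
      simp [frame_zero, frame_one, frame_two, ha, hv, hav, hva, h1, h2, h3, h4, hw] <;> field_simp
  · have : frame a v s s' = ![s⁻¹ • a, s'⁻¹ • v, (s⁻¹ * s'⁻¹) • (a ⨯₃ v)] := rfl
    -- Cycling the triple product pairs the third row with the cross product of the first two, which
    -- reduces the determinant to `hw`.
    rw [this, ← triple_product_eq_det, triple_product_permutation, triple_product_permutation]
    simp [hw]
    field_simp

theorem frame_mulVec_self {a v : Fin 3 → ℝ} {s s' : ℝ} (hs : s ≠ 0) (ha : a ⬝ᵥ a = s ^ 2)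
    (hav : a ⬝ᵥ v = 0) : frame a v s s' *ᵥ a = ![s, 0, 0] := by
  have hva : v ⬝ᵥ a = 0 := by rw [dotProduct_comm, hav]
  have h3 : (a ⨯₃ v) ⬝ᵥ a = 0 := by rw [dotProduct_comm]; exact dot_self_cross a v
  ext i
  change frame a v s s' i ⬝ᵥ a = _
  fin_cases i <;> simp [frame_zero, frame_one, frame_two, ha, hva, h3]
  field_simp

theorem mul_mul_transpose_apply (R M S : Matrix (Fin 3) (Fin 3) ℝ) (i j : Fin 3) :
    (R * M * Sᵀ) i j = R i ⬝ᵥ (M *ᵥ S j) := by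
  rw [Matrix.dotProduct_mulVec, Matrix.mul_apply']
  rfl

theorem dotProduct_mulVec_transpose (a b : Fin 3 → ℝ) (M : Matrix (Fin 3) (Fin 3) ℝ) :
    a ⬝ᵥ (M *ᵥ b) = (Mᵀ *ᵥ a) ⬝ᵥ b := by
  rw [Matrix.dotProduct_mulVec, Matrix.mulVec_transpose]

/-- `c · (b × (b × c)) = -|b × c|²`. -/
theorem dot_cross_cross_self (b c : Fin 3 → ℝ) :
    c ⬝ᵥ (b ⨯₃ (b ⨯₃ c)) = -((b ⨯₃ c) ⬝ᵥ (b ⨯₃ c)) := by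
  simp [cross_apply, dotProduct, Fin.sum_univ_three]
  ring

/-- The correlation matrix in the frames given by the invariants. -/
def sectionMatrix (t : Fin 9 → ℝ) : Matrix (Fin 3) (Fin 3) ℝ :=
  -- Products of inverses keep each entry visibly Laurent in the parameters that stand for lengths.
  !![t 4 * ((t 0)⁻¹ * (t 1)⁻¹), 0, -1 * (t 3 * ((t 0)⁻¹ * (t 1)⁻¹));
    0, t 5 * ((t 2)⁻¹ * (t 3)⁻¹), t 7 * ((t 1)⁻¹ * ((t 2)⁻¹ * (t 3)⁻¹));
    -1 * (t 2 * ((t 0)⁻¹ * (t 1)⁻¹)), t 8 * ((t 0)⁻¹ * ((t 2)⁻¹ * (t 3)⁻¹)),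
      t 6 * ((t 0)⁻¹ * ((t 1)⁻¹ * ((t 2)⁻¹ * (t 3)⁻¹)))]

/-- The correlation matrix of a symmetric state in the frame given by the invariants. -/
def sectionMatrixSym (t : Fin 6 → ℝ) : Matrix (Fin 3) (Fin 3) ℝ :=
  !![t 2 * ((t 0)⁻¹ * (t 0)⁻¹), 0, -1 * (t 1 * ((t 0)⁻¹ * (t 0)⁻¹));
    0, t 3 * ((t 1)⁻¹ * (t 1)⁻¹), t 5 * ((t 0)⁻¹ * ((t 1)⁻¹ * (t 1)⁻¹));
    -1 * (t 1 * ((t 0)⁻¹ * (t 0)⁻¹)), t 5 * ((t 0)⁻¹ * ((t 1)⁻¹ * (t 1)⁻¹)),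
      t 4 * ((t 0)⁻¹ * ((t 0)⁻¹ * ((t 1)⁻¹ * (t 1)⁻¹)))]

/-- At this point v₁ = (0, t₂, 0), w₁ = (0, 0, t₀t₂), v₂ = (0, t₃, 0) and w₂ = (0, 0, t₁t₃), so each
of f₅, …, f₉ isolates a single entry of the matrix. -/
theorem invariants_section {t : Fin 9 → ℝ} (h0 : t 0 ≠ 0) (h1 : t 1 ≠ 0) (h2 : t 2 ≠ 0)
    (h3 : t 3 ≠ 0) :
    invariants ![t 0, 0, 0] ![t 1, 0, 0] (sectionMatrix t) =
      SignDescent.sqAt {0, 1, 2, 3} t := by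
  ext i
  fin_cases i <;>
    simp [invariants, sectionMatrix, SignDescent.sqAt, cross_apply, Matrix.mulVec, dotProduct,
      Fin.sum_univ_three] <;> field_simp

theorem invariantsSym_section {t : Fin 6 → ℝ} (h0 : t 0 ≠ 0) (h1 : t 1 ≠ 0) :
    invariantsSym ![t 0, 0, 0] (sectionMatrixSym t) = SignDescent.sqAt {0, 1} t := by
  ext i
  fin_cases i <;>
    simp [invariantsSym, sectionMatrixSym, SignDescent.sqAt, cross_apply, Matrix.mulVec,
      dotProduct, Fin.sum_univ_three] <;> field_simp

/-- In the two frames the entries of the correlation matrix are the values of `M` on pairs of frame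
vectors. Five of these are invariants up to normalization; the other four are forced by the
definitions of `v` and `v'`. -/
theorem exists_rotation_to_section {a b : Fin 3 → ℝ} {M : Matrix (Fin 3) (Fin 3) ℝ}
    {t : Fin 9 → ℝ} (h0 : t 0 ≠ 0) (h1 : t 1 ≠ 0) (h2 : t 2 ≠ 0) (h3 : t 3 ≠ 0)
    (ht : invariants a b M = SignDescent.sqAt {0, 1, 2, 3} t) :
    ∃ R S, IsRotation R ∧ IsRotation S ∧ R *ᵥ a = ![t 0, 0, 0] ∧ S *ᵥ b = ![t 1, 0, 0] ∧
      R * M * Sᵀ = sectionMatrix t := by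
  have ht' := fun i => congrFun ht i
  simp [Fin.forall_fin_succ, invariants, SignDescent.sqAt] at ht'
  obtain ⟨e0, e1, e2, e3, e4, e5, e6, e7, e8⟩ := ht'
  generalize hv : a ⨯₃ (M *ᵥ b) = v at *
  generalize hv' : b ⨯₃ (Mᵀ *ᵥ a) = v' at *
  have hav : a ⬝ᵥ v = 0 := by rw [← hv]; exact dot_self_cross _ _
  have hbv : b ⬝ᵥ v' = 0 := by rw [← hv']; exact dot_self_cross _ _
  -- Moving `M` across the dot product leaves Mᵀa, which is orthogonal to v' = b × Mᵀa; in `f3` the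
  -- same move gives -|v'|².
  have f1 : a ⬝ᵥ (M *ᵥ v') = 0 := by
    rw [dotProduct_mulVec_transpose, ← hv']; exact dot_cross_self _ _
  have f2 : v ⬝ᵥ (M *ᵥ b) = 0 := by
    rw [dotProduct_comm, ← hv]; exact dot_cross_self _ _
  have f3 : a ⬝ᵥ (M *ᵥ (b ⨯₃ v')) = -t 3 ^ 2 := by
    rw [dotProduct_mulVec_transpose, ← e3, ← hv', dot_cross_cross_self]
  have f4 : (a ⨯₃ v) ⬝ᵥ (M *ᵥ b) = -t 2 ^ 2 := by
    rw [dotProduct_comm, ← e2, ← hv, dot_cross_cross_self]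
  refine ⟨frame a v (t 0) (t 2), frame b v' (t 1) (t 3), frame_isRotation h0 h2 e0 e2 hav,
    frame_isRotation h1 h3 e1 e3 hbv, frame_mulVec_self h0 e0 hav, frame_mulVec_self h1 e1 hbv, ?_⟩
  ext i j
  rw [mul_mul_transpose_apply]
  fin_cases i <;> fin_cases j <;>
    simp [frame_zero, frame_one, frame_two, sectionMatrix, Matrix.mulVec_smul, e4, e5,
      e6, e7, e8, f1, f2, f3, f4] <;>
    field_simp

theorem exists_rotation_to_sectionSym {a : Fin 3 → ℝ} {M : Matrix (Fin 3) (Fin 3) ℝ}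
    (hM : Mᵀ = M) {t : Fin 6 → ℝ} (h0 : t 0 ≠ 0) (h1 : t 1 ≠ 0)
    (ht : invariantsSym a M = SignDescent.sqAt {0, 1} t) :
    ∃ R, IsRotation R ∧ R *ᵥ a = ![t 0, 0, 0] ∧ R * M * Rᵀ = sectionMatrixSym t := by
  have ht' := fun i => congrFun ht i
  simp [Fin.forall_fin_succ, invariantsSym, SignDescent.sqAt] at ht'
  obtain ⟨e0, e1, e2, e3, e4, e5⟩ := ht'
  generalize hv : a ⨯₃ (M *ᵥ a) = v at *
  -- Symmetry of `M` supplies the entries across the diagonal, so one frame and six invariants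
  -- suffice.
  have hsymm : ∀ x y : Fin 3 → ℝ, x ⬝ᵥ (M *ᵥ y) = y ⬝ᵥ (M *ᵥ x) := fun x y => by
    rw [dotProduct_mulVec_transpose, hM, dotProduct_comm]
  have hav : a ⬝ᵥ v = 0 := by rw [← hv]; exact dot_self_cross _ _
  have f2 : v ⬝ᵥ (M *ᵥ a) = 0 := by
    rw [dotProduct_comm, ← hv]; exact dot_cross_self _ _
  have f1 : a ⬝ᵥ (M *ᵥ v) = 0 := by rw [hsymm, f2]
  have f4 : (a ⨯₃ v) ⬝ᵥ (M *ᵥ a) = -t 1 ^ 2 := by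
    rw [dotProduct_comm, ← e1, ← hv, dot_cross_cross_self]
  have f3 : a ⬝ᵥ (M *ᵥ (a ⨯₃ v)) = -t 1 ^ 2 := by rw [hsymm, f4]
  have e6 : v ⬝ᵥ (M *ᵥ (a ⨯₃ v)) = t 5 := by rw [hsymm, e5]
  refine ⟨frame a v (t 0) (t 1), frame_isRotation h0 h1 e0 e1 hav, frame_mulVec_self h0 e0 hav, ?_⟩
  ext i j
  rw [mul_mul_transpose_apply]
  fin_cases i <;> fin_cases j <;>
    simp [frame_zero, frame_one, frame_two, sectionMatrixSym, Matrix.mulVec_smul, e2,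
      e3, e4, e5, e6, f1, f2, f3, f4] <;>
    field_simp

end TwoQubit

end

/-! ### Local unitary evolution in Bloch coordinates -/

noncomputable section

namespace TwoQubit

/-- The Bloch vector of the first qubit. -/
def blochFst (ρ : Op) : Fin 3 → ℝ := fun i => bloch ρ i.succ 0

/-- The Bloch vector of the second qubit. -/
def blochSnd (ρ : Op) : Fin 3 → ℝ := fun j => bloch ρ 0 j.succ

/-- The matrix of 2-point correlations. -/
def correlation (ρ : Op) : Matrix (Fin 3) (Fin 3) ℝ :=
  Matrix.of fun i j => bloch ρ i.succ j.succ

/-- The Bloch matrix with given Bloch vectors and correlation matrix. -/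
def blochMatrix (a b : Fin 3 → ℝ) (M : Matrix (Fin 3) (Fin 3) ℝ) : Fin 4 → Fin 4 → ℝ :=
  Fin.cons (Fin.cons 1 b) fun i => Fin.cons (a i) (M i)

theorem pauli_zero : pauli 0 = 1 := by
  ext i j
  fin_cases i <;> fin_cases j <;> simp [pauli]

/-- Cyclicity of the trace moves the conjugation from the state to the Pauli matrices, one tensor
factor at a time. -/
theorem bloch_conj (U : SU2 × SU2) (ρ : Op) (i j : Fin 4) :
    bloch (localUnitary U * ρ * (localUnitary U)ᴴ) i j =
      (ρ * (((U.1 : Matrix (Fin 2) (Fin 2) ℂ)ᴴ * pauli i * (U.1 : Matrix _ _ ℂ)) ⊗ₖ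
        ((U.2 : Matrix (Fin 2) (Fin 2) ℂ)ᴴ * pauli j * (U.2 : Matrix _ _ ℂ)))).trace.re := by
  rw [bloch, reTraceMul_apply, Matrix.mul_kronecker_mul, Matrix.mul_kronecker_mul,
    ← Matrix.conjTranspose_kronecker]
  change (localUnitary U * ρ * (localUnitary U)ᴴ * _).trace.re =
    (ρ * ((localUnitary U)ᴴ * _ * localUnitary U)).trace.re
  rw [Matrix.mul_assoc, Matrix.mul_assoc, Matrix.trace_mul_comm, Matrix.mul_assoc,
    Matrix.mul_assoc]

theorem conj_pauli_zero (U : SU2) :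
    (U : Matrix (Fin 2) (Fin 2) ℂ)ᴴ * pauli 0 * U = pauli 0 := by
  rw [pauli_zero, Matrix.mul_one]
  exact U.2.1.1

/-- `R` is the rotation of Bloch vectors induced by `U`. -/
def Rotates (U : SU2) (R : Matrix (Fin 3) (Fin 3) ℝ) : Prop := ∀ i : Fin 3,
  (U : Matrix (Fin 2) (Fin 2) ℂ)ᴴ * pauli i.succ * U = ∑ j : Fin 3, (R i j : ℂ) • pauli j.succ

section

variable {U : SU2 × SU2} {R S : Matrix (Fin 3) (Fin 3) ℝ} (ρ : Op)

theorem blochFst_conj (hR : Rotates U.1 R) :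
    blochFst (localUnitary U * ρ * (localUnitary U)ᴴ) = R *ᵥ blochFst ρ := by
  funext i
  rw [blochFst, bloch_conj, hR, conj_pauli_zero]
  simp [Matrix.mulVec, dotProduct, Fin.sum_univ_three, Matrix.add_kronecker,
    Matrix.smul_kronecker, Matrix.mul_add, blochFst, bloch, reTraceMul_apply]

theorem blochSnd_conj (hS : Rotates U.2 S) :
    blochSnd (localUnitary U * ρ * (localUnitary U)ᴴ) = S *ᵥ blochSnd ρ := by
  funext i
  rw [blochSnd, bloch_conj, hS, conj_pauli_zero]
  simp [Matrix.mulVec, dotProduct, Fin.sum_univ_three, Matrix.kronecker_add,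
    Matrix.kronecker_smul, Matrix.mul_add, blochSnd, bloch, reTraceMul_apply]

theorem correlation_conj (hR : Rotates U.1 R) (hS : Rotates U.2 S) :
    correlation (localUnitary U * ρ * (localUnitary U)ᴴ) = R * correlation ρ * Sᵀ := by
  ext i j
  rw [correlation, Matrix.of_apply, bloch_conj, hR, hS]
  simp [Matrix.mul_apply, Fin.sum_univ_three, Matrix.kronecker_add, Matrix.add_kronecker,
    Matrix.smul_kronecker, Matrix.kronecker_smul, Matrix.mul_add, correlation, bloch,
    reTraceMul_apply]
  ring

end

theorem bloch_eq_blochMatrix {ρ : Op} (h : ρ ∈ liouville) :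
    bloch ρ = blochMatrix (blochFst ρ) (blochSnd ρ) (correlation ρ) := by
  funext i j
  refine Fin.cases ?_ (fun i => ?_) i <;> refine Fin.cases ?_ (fun j => ?_) j
  · simp [blochMatrix, bloch_zero_zero h]
  all_goals simp [blochMatrix, blochFst, blochSnd, correlation]

theorem eq_of_blochMatrix_eq {ρ τ : Op} (hρ : ρ ∈ liouville) (hτ : τ ∈ liouville)
    (h1 : blochFst ρ = blochFst τ) (h2 : blochSnd ρ = blochSnd τ)
    (h3 : correlation ρ = correlation τ) : ρ = τ :=
  eq_of_bloch_eq hρ hτ fun i j => by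
    rw [bloch_eq_blochMatrix hρ, bloch_eq_blochMatrix hτ, h1, h2, h3]

section

variable (a b : Fin 3 → ℝ) (M : Matrix (Fin 3) (Fin 3) ℝ)

theorem blochFst_ofBloch : blochFst (ofBloch (blochMatrix a b M)) = a := by
  funext i
  simp [blochFst, bloch_ofBloch, blochMatrix]

theorem blochSnd_ofBloch : blochSnd (ofBloch (blochMatrix a b M)) = b := by
  funext i
  simp [blochSnd, bloch_ofBloch, blochMatrix]

theorem correlation_ofBloch : correlation (ofBloch (blochMatrix a b M)) = M := by
  ext i j
  simp [correlation, bloch_ofBloch, blochMatrix]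

theorem blochMatrix_symm {M : Matrix (Fin 3) (Fin 3) ℝ} (hM : Mᵀ = M) (i j : Fin 4) :
    blochMatrix a a M i j = blochMatrix a a M j i := by
  refine Fin.cases ?_ (fun i => ?_) i <;> refine Fin.cases ?_ (fun j => ?_) j
  · rfl
  · simp [blochMatrix]
  · simp [blochMatrix]
  · simpa [blochMatrix] using (congrFun (congrFun hM i) j).symm

end

/-- Polynomial dependence of the Bloch matrix on parameters carries over to the matrix entries. -/
theorem isLaurent_ofBloch {ι : Type*} {J : Finset ι} {B : (ι → ℝ) → Fin 4 → Fin 4 → ℝ}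
    (hB : ∀ i j, IsLaurent J fun t => B t i j) (a b : Fin 2 × Fin 2) :
    IsLaurent J (fun t => (ofBloch (B t) a b).re) ∧
      IsLaurent J (fun t => (ofBloch (B t) a b).im) := by
  constructor
  · refine IsLaurent.congr ((IsLaurent.const (1 / 4)).mul <| IsLaurent.sum Finset.univ fun i _ =>
      IsLaurent.sum Finset.univ fun j _ =>
        (hB i j).mul (IsLaurent.const ((pauli i ⊗ₖ pauli j) a b).re)) fun t _ => ?_
    simp [ofBloch, Matrix.sum_apply]
  · refine IsLaurent.congr ((IsLaurent.const (1 / 4)).mul <| IsLaurent.sum Finset.univ fun i _ =>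
      IsLaurent.sum Finset.univ fun j _ =>
        (hB i j).mul (IsLaurent.const ((pauli i ⊗ₖ pauli j) a b).im)) fun t _ => ?_
    simp [ofBloch, Matrix.sum_apply]

theorem isLaurent_blochMatrix {ι : Type*} {J : Finset ι} {a b : (ι → ℝ) → Fin 3 → ℝ}
    {M : (ι → ℝ) → Matrix (Fin 3) (Fin 3) ℝ} (ha : ∀ i, IsLaurent J fun t => a t i)
    (hb : ∀ i, IsLaurent J fun t => b t i) (hM : ∀ i j, IsLaurent J fun t => M t i j)
    (i j : Fin 4) : IsLaurent J fun t => blochMatrix (a t) (b t) (M t) i j := by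
  refine Fin.cases ?_ (fun i => ?_) i <;> refine Fin.cases ?_ (fun j => ?_) j
  · simpa [blochMatrix] using IsLaurent.const 1
  · simpa [blochMatrix] using hb j
  · simpa [blochMatrix] using ha i
  · simpa [blochMatrix] using hM i j

/-! ### The generating invariants as functions -/

/-- Evaluation of integer polynomials at the Bloch matrix of an operator. -/
def evalAt (ρ : Op) : BlochPoly →+* ℝ :=
  (MvPolynomial.aeval fun ij : Fin 4 × Fin 4 => bloch ρ ij.1 ij.2 : BlochPoly →ₐ[ℤ] ℝ)

theorem aeval_blochCoord_apply (X : AffineSubspace ℝ Op) (p : BlochPoly) (ρ : X) :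
    (MvPolynomial.aeval (blochCoord X) p : coordRing X).1 ρ = evalAt ρ p := by
  induction p using MvPolynomial.induction_on with
  | C n => simp
  | add p q hp hq => rw [map_add, map_add, ← hp, ← hq]; rfl
  | mul_X p i hp =>
    rw [map_mul, map_mul, ← hp, MvPolynomial.aeval_X]
    simp [evalAt]
    exact Or.inl rfl

theorem map_cross {R S : Type*} [CommRing R] [CommRing S] (φ : R →+* S) (a b : Fin 3 → R) :
    φ ∘ (a ⨯₃ b) = (φ ∘ a) ⨯₃ (φ ∘ b) := by
  ext i
  fin_cases i <;> simp [cross_apply]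

theorem comp_mulVec {R S : Type*} [CommRing R] [CommRing S] (φ : R →+* S)
    (M : Matrix (Fin 3) (Fin 3) R) (b : Fin 3 → R) :
    φ ∘ (M *ᵥ b) = (M.map φ) *ᵥ (φ ∘ b) :=
  funext fun i => RingHom.map_mulVec φ M b i

theorem evalAt_comp_u₁ (ρ : Op) : evalAt ρ ∘ u₁ = blochFst ρ := by
  funext i
  simp [evalAt, u₁, blochFst]

theorem evalAt_comp_u₂ (ρ : Op) : evalAt ρ ∘ u₂ = blochSnd ρ := by
  funext i
  simp [evalAt, u₂, blochSnd]

theorem map_evalAt_C (ρ : Op) : C.map (evalAt ρ) = correlation ρ := by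
  ext i j
  simp [evalAt, C, correlation]

/-- Evaluation is a ring homomorphism, so it passes through dot, cross and matrix-vector products.
-/
theorem evalAt_invariantPoly (ρ : Op) (i : Fin 9) :
    evalAt ρ (invariantPoly i) = invariants (blochFst ρ) (blochSnd ρ) (correlation ρ) i := by
  have hT : Cᵀ.map (evalAt ρ) = (correlation ρ)ᵀ := by rw [← map_evalAt_C, Matrix.transpose_map]
  fin_cases i <;>
    simp [invariantPoly, invariants, RingHom.map_dotProduct, w₁, w₂, v₁, v₂, map_cross,
      comp_mulVec, evalAt_comp_u₁, evalAt_comp_u₂, map_evalAt_C, hT]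

theorem evalAt_invariantPolySym (ρ : Op) (i : Fin 6) :
    evalAt ρ (invariantPolySym i) = invariantsSym (blochFst ρ) (correlation ρ) i := by
  fin_cases i <;>
    simp [invariantPolySym, invariantsSym, RingHom.map_dotProduct, wSym, vSym, map_cross,
      comp_mulVec, evalAt_comp_u₁, map_evalAt_C]

/-! ### The main theorem -/

theorem invariants_conj (U : SU2 × SU2) (ρ : Op) :
    invariants (blochFst (localUnitary U * ρ * (localUnitary U)ᴴ))
      (blochSnd (localUnitary U * ρ * (localUnitary U)ᴴ))
      (correlation (localUnitary U * ρ * (localUnitary U)ᴴ)) =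
    invariants (blochFst ρ) (blochSnd ρ) (correlation ρ) := by
  obtain ⟨R, hR, hRd, hU⟩ := exists_rotation U.1
  obtain ⟨S, hS, hSd, hV⟩ := exists_rotation U.2
  rw [blochFst_conj ρ hU, blochSnd_conj ρ hV, correlation_conj ρ hU hV,
    invariants_rotation ⟨hR, hRd⟩ ⟨hS, hSd⟩]

theorem invariantsSym_conj (U : SU2) (ρ : Op) :
    invariantsSym (blochFst (localUnitary (U, U) * ρ * (localUnitary (U, U))ᴴ))
      (correlation (localUnitary (U, U) * ρ * (localUnitary (U, U))ᴴ)) =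
    invariantsSym (blochFst ρ) (correlation ρ) := by
  obtain ⟨R, hR, hRd, hU⟩ := exists_rotation U
  rw [blochFst_conj (U := (U, U)) ρ hU, correlation_conj (U := (U, U)) ρ hU hU,
    invariantsSym_rotation ⟨hR, hRd⟩]

/-- The rational section of the invariants on Liouville space. -/
def liouvilleSection (t : Fin 9 → ℝ) : liouville :=
  ⟨ofBloch (blochMatrix ![t 0, 0, 0] ![t 1, 0, 0] (sectionMatrix t)), ofBloch_mem_liouville rfl⟩

theorem sectionMatrixSym_transpose (t : Fin 6 → ℝ) :
    (sectionMatrixSym t)ᵀ = sectionMatrixSym t := by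
  ext i j
  fin_cases i <;> fin_cases j <;> rfl

/-- The rational section of the invariants on symmetric states. -/
def liouvilleSymSection (t : Fin 6 → ℝ) : liouvilleSym :=
  ⟨ofBloch (blochMatrix ![t 0, 0, 0] ![t 0, 0, 0] (sectionMatrixSym t)),
    ofBloch_mem_liouvilleSym rfl (blochMatrix_symm _ (sectionMatrixSym_transpose t))⟩

theorem blochSnd_eq_blochFst {ρ : Op} (h : ρ ∈ liouvilleSym) : blochSnd ρ = blochFst ρ :=
  funext fun _ => bloch_symm h _ _

theorem correlation_transpose {ρ : Op} (h : ρ ∈ liouvilleSym) :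
    (correlation ρ)ᵀ = correlation ρ := by
  ext i j
  exact bloch_symm h _ _

theorem isLaurent_vec {ι : Type*} {J : Finset ι} (i : ι) (k : Fin 3) :
    IsLaurent J fun t => ![t i, 0, 0] k := by
  fin_cases k
  · exact IsLaurent.coord i
  · exact IsLaurent.const 0
  · exact IsLaurent.const 0

theorem isLaurent_sectionMatrix (i j : Fin 3) :
    IsLaurent {0, 1, 2, 3} fun t => sectionMatrix t i j := by
  have h0 : IsLaurent {0, 1, 2, 3} fun t : Fin 9 → ℝ => (t 0)⁻¹ := IsLaurent.inv_coord (by simp)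
  have h1 : IsLaurent {0, 1, 2, 3} fun t : Fin 9 → ℝ => (t 1)⁻¹ := IsLaurent.inv_coord (by simp)
  have h2 : IsLaurent {0, 1, 2, 3} fun t : Fin 9 → ℝ => (t 2)⁻¹ := IsLaurent.inv_coord (by simp)
  have h3 : IsLaurent {0, 1, 2, 3} fun t : Fin 9 → ℝ => (t 3)⁻¹ := IsLaurent.inv_coord (by simp)
  have h23 := h2.mul h3
  fin_cases i <;> fin_cases j
  · exact (IsLaurent.coord 4).mul (h0.mul h1)
  · exact IsLaurent.const 0
  · exact (IsLaurent.const (-1)).mul ((IsLaurent.coord 3).mul (h0.mul h1))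
  · exact IsLaurent.const 0
  · exact (IsLaurent.coord 5).mul h23
  · exact (IsLaurent.coord 7).mul (h1.mul h23)
  · exact (IsLaurent.const (-1)).mul ((IsLaurent.coord 2).mul (h0.mul h1))
  · exact (IsLaurent.coord 8).mul (h0.mul h23)
  · exact (IsLaurent.coord 6).mul (h0.mul (h1.mul h23))

theorem isLaurent_sectionMatrixSym (i j : Fin 3) :
    IsLaurent {0, 1} fun t => sectionMatrixSym t i j := by
  have h0 : IsLaurent {0, 1} fun t : Fin 6 → ℝ => (t 0)⁻¹ := IsLaurent.inv_coord (by simp)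
  have h1 : IsLaurent {0, 1} fun t : Fin 6 → ℝ => (t 1)⁻¹ := IsLaurent.inv_coord (by simp)
  have h00 := h0.mul h0
  have h11 := h1.mul h1
  fin_cases i <;> fin_cases j
  · exact (IsLaurent.coord 2).mul h00
  · exact IsLaurent.const 0
  · exact (IsLaurent.const (-1)).mul ((IsLaurent.coord 1).mul h00)
  · exact IsLaurent.const 0
  · exact (IsLaurent.coord 3).mul h11
  · exact (IsLaurent.coord 5).mul (h0.mul h11)
  · exact (IsLaurent.const (-1)).mul ((IsLaurent.coord 1).mul h00)
  · exact (IsLaurent.coord 5).mul (h0.mul h11)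
  · exact (IsLaurent.coord 4).mul (h0.mul (h0.mul h11))

/-- The two rotations onto the section lift to SU(2), and a state in Liouville space is determined
by its Bloch vectors and correlation matrix. -/
theorem exists_smul_eq_liouvilleSection (ρ : liouville) (t : Fin 9 → ℝ)
    (ht : ∀ i ∈ ({0, 1, 2, 3} : Finset (Fin 9)), t i ≠ 0)
    (h : invariants (blochFst ρ) (blochSnd ρ) (correlation ρ) =
      SignDescent.sqAt {0, 1, 2, 3} t) :
    ∃ g : SU2 × SU2, g • ρ = liouvilleSection t := by
  obtain ⟨R, S, hR, hS, h1, h2, h3⟩ := exists_rotation_to_section (ht 0 (by simp))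
    (ht 1 (by simp)) (ht 2 (by simp)) (ht 3 (by simp)) h
  obtain ⟨U, hU⟩ := exists_su2_of_rotation hR.1 hR.2
  obtain ⟨V, hV⟩ := exists_su2_of_rotation hS.1 hS.2
  refine ⟨(U, V), Subtype.ext (eq_of_blochMatrix_eq ((U, V) • ρ).2 (liouvilleSection t).2
    ?_ ?_ ?_)⟩
  · exact (blochFst_conj (U := (U, V)) _ hU).trans (h1.trans (blochFst_ofBloch _ _ _).symm)
  · exact (blochSnd_conj (U := (U, V)) _ hV).trans (h2.trans (blochSnd_ofBloch _ _ _).symm)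
  · exact (correlation_conj (U := (U, V)) _ hU hV).trans
      (h3.trans (correlation_ofBloch _ _ _).symm)

theorem exists_smul_eq_liouvilleSymSection (ρ : liouvilleSym) (t : Fin 6 → ℝ)
    (ht : ∀ i ∈ ({0, 1} : Finset (Fin 6)), t i ≠ 0)
    (h : invariantsSym (blochFst ρ) (correlation ρ) = SignDescent.sqAt {0, 1} t) :
    ∃ g : SU2, g • ρ = liouvilleSymSection t := by
  obtain ⟨R, hR, h1, h2⟩ := exists_rotation_to_sectionSym (correlation_transpose ρ.2)
    (ht 0 (by simp)) (ht 1 (by simp)) h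
  obtain ⟨U, hU⟩ := exists_su2_of_rotation hR.1 hR.2
  have hfst : blochFst (U • ρ : liouvilleSym) = blochFst (liouvilleSymSection t) :=
    (blochFst_conj (U := (U, U)) _ hU).trans (h1.trans (blochFst_ofBloch _ _ _).symm)
  refine ⟨U, Subtype.ext (eq_of_blochMatrix_eq (U • ρ).2.1 (liouvilleSymSection t).2.1 hfst
    ?_ ?_)⟩
  · rw [blochSnd_eq_blochFst (U • ρ).2, blochSnd_eq_blochFst (liouvilleSymSection t).2, hfst]
  · exact (correlation_conj (U := (U, U)) _ hU hU).trans
      (h2.trans (correlation_ofBloch _ _ _).symm)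

theorem dotProduct_self_nonneg_real (a : Fin 3 → ℝ) : 0 ≤ a ⬝ᵥ a :=
  Finset.sum_nonneg fun i _ => mul_self_nonneg (a i)

theorem invariants_nonneg (a b : Fin 3 → ℝ) (M : Matrix (Fin 3) (Fin 3) ℝ) {i : Fin 9}
    (hi : i ∈ ({0, 1, 2, 3} : Finset (Fin 9))) : 0 ≤ invariants a b M i := by
  simp only [Finset.mem_insert, Finset.mem_singleton] at hi
  rcases hi with rfl | rfl | rfl | rfl <;> exact dotProduct_self_nonneg_real _

theorem invariantsSym_nonneg (a : Fin 3 → ℝ) (M : Matrix (Fin 3) (Fin 3) ℝ) {i : Fin 6}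
    (hi : i ∈ ({0, 1} : Finset (Fin 6))) : 0 ≤ invariantsSym a M i := by
  simp only [Finset.mem_insert, Finset.mem_singleton] at hi
  rcases hi with rfl | rfl <;> exact dotProduct_self_nonneg_real _

theorem invariantField_liouville :
    (∀ i, evalBloch liouville (invariantPoly i) ∈
        invariantField (SU2 × SU2) liouville) ∧
      AlgebraicIndependent ℝ
        (fun i => evalBloch liouville (invariantPoly i)) ∧
      IntermediateField.adjoin ℝ
          (Set.range fun i => evalBloch liouville (invariantPoly i)) =
        invariantField (SU2 × SU2) liouville ∧
      Nonempty (FractionRing (MvPolynomial (Fin 9) ℝ) ≃ₐ[ℝ]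
        invariantField (SU2 × SU2) liouville) :=
  -- `J` marks f₁, …, f₄, the squared lengths whose square roots parametrize the section.
  invariantField_of_section (G := SU2 × SU2) (X := liouville) (J := {0, 1, 2, 3})
    (f := fun i => MvPolynomial.aeval (blochCoord liouville) (invariantPoly i))
    (s := liouvilleSection)
    (fun i g x => by
      rw [aeval_blochCoord_apply, aeval_blochCoord_apply, evalAt_invariantPoly,
        evalAt_invariantPoly]
      exact congrFun (invariants_conj g x) i)
    (fun i hi x => by
      rw [aeval_blochCoord_apply, evalAt_invariantPoly]
      exact invariants_nonneg _ _ _ hi)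
    (fun t ht i => by
      rw [aeval_blochCoord_apply, evalAt_invariantPoly, liouvilleSection, blochFst_ofBloch,
        blochSnd_ofBloch, correlation_ofBloch,
        invariants_section (ht 0 (by simp)) (ht 1 (by simp)) (ht 2 (by simp)) (ht 3 (by simp))])
    (fun a b => (isLaurent_ofBloch (isLaurent_blochMatrix (isLaurent_vec 0) (isLaurent_vec 1)
      isLaurent_sectionMatrix) a b).1)
    (fun a b => (isLaurent_ofBloch (isLaurent_blochMatrix (isLaurent_vec 0) (isLaurent_vec 1)
      isLaurent_sectionMatrix) a b).2)
    (fun x t ht h => exists_smul_eq_liouvilleSection x t ht <| funext fun i => by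
      rw [← h i, aeval_blochCoord_apply, evalAt_invariantPoly])

theorem invariantField_liouvilleSym :
    (∀ i, evalBloch liouvilleSym (invariantPolySym i) ∈
        invariantField SU2 liouvilleSym) ∧
      AlgebraicIndependent ℝ
        (fun i => evalBloch liouvilleSym (invariantPolySym i)) ∧
      IntermediateField.adjoin ℝ
          (Set.range fun i =>
            evalBloch liouvilleSym (invariantPolySym i)) =
        invariantField SU2 liouvilleSym ∧
      Nonempty (FractionRing (MvPolynomial (Fin 6) ℝ) ≃ₐ[ℝ]
        invariantField SU2 liouvilleSym) :=
  -- Only u·u and v·v enter through square roots.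
  invariantField_of_section (G := SU2) (X := liouvilleSym) (J := {0, 1})
    (f := fun i => MvPolynomial.aeval (blochCoord liouvilleSym) (invariantPolySym i))
    (s := liouvilleSymSection)
    (fun i g x => by
      rw [aeval_blochCoord_apply, aeval_blochCoord_apply, evalAt_invariantPolySym,
        evalAt_invariantPolySym]
      exact congrFun (invariantsSym_conj g x) i)
    (fun i hi x => by
      rw [aeval_blochCoord_apply, evalAt_invariantPolySym]
      exact invariantsSym_nonneg _ _ hi)
    (fun t ht i => by
      rw [aeval_blochCoord_apply, evalAt_invariantPolySym, liouvilleSymSection, blochFst_ofBloch,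
        correlation_ofBloch, invariantsSym_section (ht 0 (by simp)) (ht 1 (by simp))])
    (fun a b => (isLaurent_ofBloch (isLaurent_blochMatrix (isLaurent_vec 0) (isLaurent_vec 0)
      isLaurent_sectionMatrixSym) a b).1)
    (fun a b => (isLaurent_ofBloch (isLaurent_blochMatrix (isLaurent_vec 0) (isLaurent_vec 0)
      isLaurent_sectionMatrixSym) a b).2)
    (fun x t ht h => exists_smul_eq_liouvilleSymSection x t ht <| funext fun i => by
      rw [← h i, aeval_blochCoord_apply, evalAt_invariantPolySym])

end TwoQubit

end

theorem mainTheorem3 :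
    ((∀ i, TwoQubit.evalBloch TwoQubit.liouville (TwoQubit.invariantPoly i) ∈
        TwoQubit.invariantField (TwoQubit.SU2 × TwoQubit.SU2) TwoQubit.liouville) ∧
      AlgebraicIndependent ℝ
        (fun i => TwoQubit.evalBloch TwoQubit.liouville (TwoQubit.invariantPoly i)) ∧
      IntermediateField.adjoin ℝ
          (Set.range fun i => TwoQubit.evalBloch TwoQubit.liouville (TwoQubit.invariantPoly i)) =
        TwoQubit.invariantField (TwoQubit.SU2 × TwoQubit.SU2) TwoQubit.liouville ∧
      Nonempty (FractionRing (MvPolynomial (Fin 9) ℝ) ≃ₐ[ℝ]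
        TwoQubit.invariantField (TwoQubit.SU2 × TwoQubit.SU2) TwoQubit.liouville)) ∧
    ((∀ i, TwoQubit.evalBloch TwoQubit.liouvilleSym (TwoQubit.invariantPolySym i) ∈
        TwoQubit.invariantField TwoQubit.SU2 TwoQubit.liouvilleSym) ∧
      AlgebraicIndependent ℝ
        (fun i => TwoQubit.evalBloch TwoQubit.liouvilleSym (TwoQubit.invariantPolySym i)) ∧
      IntermediateField.adjoin ℝ
          (Set.range fun i =>
            TwoQubit.evalBloch TwoQubit.liouvilleSym (TwoQubit.invariantPolySym i)) =
        TwoQubit.invariantField TwoQubit.SU2 TwoQubit.liouvilleSym ∧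
      Nonempty (FractionRing (MvPolynomial (Fin 6) ℝ) ≃ₐ[ℝ]
        TwoQubit.invariantField TwoQubit.SU2 TwoQubit.liouvilleSym)) :=
  ⟨TwoQubit.invariantField_liouville, TwoQubit.invariantField_liouvilleSym⟩
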